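/- For an open set $U\subset\mathbb{R}^m$ put $$\Lambda(U;1)=\inf_{v\in H^1(U),\,v\not\equiv0}\frac{\int_U|\nabla v|^2\,dx-\int_{\partial U}|v|^2\,ds}{\int_U|v|^2\,dx}\in[-\infty,\infty],$$ with boundary values in the sense of traces. For an open set $\Omega\subset\mathbb{R}^m$ and $y\in\partial\Omega$ we write $\Omega\sim K_y$ near $y$ if $K_y$ is an (infinite) cone and, for some $r>0$, there is a $C^\infty$ diffeomorphism $f$ of $K_y\cap B(0,r)$ onto $\Omega\cap B(y,r)$ with $f(0)=y$ and derivative at $0$ equal to the identity; then $C_y:=-\Lambda(K_y;1)$. Let $4\le j\le m$ and let $y\in\partial\Omega$ be a singular point of codimension $j$ with convex cross-section: $\Omega\sim K_y$ near $y$, where, up to an orthogonal change of coordinates, $K_y=\mathbb{R}^{m-j}\times\tilde K$, $\tilde K=\{z\in\mathbb{R}^j: z/|z|\in\tilde M\}$, and $\tilde M\subset S^{j-1}$ is open and geodesically convex with closure contained in an open hemisphere. For $\theta\in\tilde M$ let $\Pi_\theta$ be the hyperplane through $\theta$ orthogonal to $\theta$, and $P_\theta=\Pi_\theta\cap\partial\tilde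 K$. Call $\theta\in\tilde M$ admissible if $P_\theta$ is bounded. For admissible $\theta$ let $S^{j-2}$ be the unit sphere of $\theta^\perp$ and define $b_\theta:S^{j-2}\to(0,\infty)$ by $P_\theta=\{\theta+b_\theta(\phi)\phi:\ \phi\in S^{j-2}\}$. At the points $\phi$ where $b_\theta$ is differentiable let $\nabla b_\theta(\phi)$ be its gradient on $S^{j-2}$, and put $$\zeta_\theta=b_\theta\nabla b_\theta,\qquad Z_\theta=b_\theta^2 I+\nabla b_\theta\otimes\nabla b_\theta,\qquad \Psi_\theta=Z_\theta^{-1}\zeta_\theta,$$ $$\Sigma_\theta=\sqrt{1+\left((b_\theta-\Psi_\theta\cdot\nabla b_\theta)^2+b_\theta^2|\Psi_\theta|^2\right)^{-1}}.$$ Then admissible $\theta$ exist; for each of them $b_\theta$ is well defined and differentiable almost everywhere, $b_\theta^{j-1}$ and $b_\theta^{j-1}\Sigma_\theta$ are integrable over $S^{j-2}$, and $\int_{S^{j-2}}b_\theta^{j-1}\,d\phi>0$. Moreover $$\sup_\theta\left(\frac{\int_{S^{j-2}}b_\theta^{j-1}\,\Sigma_\theta\,d\phi}{\int_{S^{j-2}}b_\theta^{j-1}\,d\phi}\right)^2\le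 C_y\le\inf_\theta\sup_\phi\Sigma_\theta(\phi)^2,$$ where $\theta$ runs over the admissible directions and $\phi$ over the points of differentiability of $b_\theta$. The bounds are exact, i.e. the supremum on the left, $C_y$ and the infimum on the right all coincide, if $\tilde M$ is a spherical polyhedron (a finite intersection of open hemispheres) which admits an inscribed ball (a spherical ball contained in $\tilde M$ and touching all its faces) whose centre is an admissible direction. -/

import Mathlib

open MeasureTheory Metric Set Filter Topology
open scoped RealInnerProductSpace ContDiff

noncomputable section

namespace Robin

/-- The Euclidean space `ℝⁿ`. -/
abbrev Euc (n : ℕ) : Type := EuclideanSpace ℝ (Fin n)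

/-- The unit sphere `S^{n-1}` in `ℝⁿ`. -/
abbrev Sph (n : ℕ) : Type := sphere (0 : Euc n) 1

/-! ### The Robin problem and the bottom of its spectrum -/

/-- The surface measure `ds` on the boundary of `U ⊆ ℝⁿ`: the `(n-1)`-dimensional Hausdorff measure
for the Euclidean distance, with the usual normalisation, restricted to `∂U`. -/
def bdryMeasure {n : ℕ} (U : Set (Euc n)) : Measure (Euc n) :=
  (Measure.euclideanHausdorffMeasure (n - 1) : Measure (Euc n)).restrict (frontier U)

/-- `w` is the weak gradient of `v` in `U`. -/
def IsWeakGradient {n : ℕ} (U : Set (Euc n)) (v : Euc n → ℝ) (w : Euc n → Euc n) : Prop :=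
  ∀ χ : Euc n → ℝ, ContDiff ℝ ∞ χ → HasCompactSupport χ → tsupport χ ⊆ U →
    ∫ x in U, v x • gradient χ x = -∫ x in U, χ x • w x

/-- `v ∈ H¹(U)`, with weak gradient `w`. -/
structure IsH1 {n : ℕ} (U : Set (Euc n)) (v : Euc n → ℝ) (w : Euc n → Euc n) : Prop where
  memLp : MemLp v 2 (volume.restrict U)
  memLp_grad : MemLp w 2 (volume.restrict U)
  weak : IsWeakGradient U v w

/-- `g ∈ L²(∂U, ds)` is the boundary trace of `v ∈ H¹(U)` (with weak gradient `w`): the trace is the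
extension by continuity of the restriction `u ↦ u|_{∂U}` of functions `u ∈ C_c^∞(ℝⁿ)`. On a domain
with (uniformly) Lipschitz boundary, such as a convex cone, these functions are dense in `H¹(U)` and
every `v ∈ H¹(U)` has exactly one trace. -/
structure IsTrace {n : ℕ} (U : Set (Euc n)) (v : Euc n → ℝ) (w : Euc n → Euc n)
    (g : Euc n → ℝ) : Prop where
  memLp : MemLp g 2 (bdryMeasure U)
  approx : ∃ u : ℕ → Euc n → ℝ, (∀ k, ContDiff ℝ ∞ (u k) ∧ HasCompactSupport (u k)) ∧
    Tendsto (fun k => eLpNorm (fun x => u k x - v x) 2 (volume.restrict U)) atTop (𝓝 0) ∧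
    Tendsto (fun k => eLpNorm (fun x => gradient (u k) x - w x) 2 (volume.restrict U))
      atTop (𝓝 0) ∧
    Tendsto (fun k => eLpNorm (fun x => u k x - g x) 2 (bdryMeasure U)) atTop (𝓝 0)

/-- The Rayleigh quotient of `v`, with weak gradient `w` and boundary trace `g`. -/
def rayleigh {n : ℕ} (U : Set (Euc n)) (γ : ℝ) (v : Euc n → ℝ) (w : Euc n → Euc n)
    (g : Euc n → ℝ) : ℝ :=
  ((∫ x in U, ‖w x‖ ^ 2) - γ * ∫ x, g x ^ 2 ∂(bdryMeasure U)) / ∫ x in U, v x ^ 2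

/-- `Λ(U; γ)`, the infimum of the Rayleigh quotient over all `v ∈ H¹(U)`, `v ≢ 0`
(possibly `-∞`). -/
def bottom {n : ℕ} (U : Set (Euc n)) (γ : ℝ) : EReal :=
  sInf {t : EReal | ∃ (v : Euc n → ℝ) (w : Euc n → Euc n) (g : Euc n → ℝ),
    IsH1 U v w ∧ IsTrace U v w g ∧ ¬ v =ᵐ[volume.restrict U] 0 ∧
      t = ((rayleigh U γ v w g : ℝ) : EReal)}

/-! ### Model cones -/

/-- `Ω ∼ K` near `y`: `K` is a cone, and some smooth diffeomorphism `f` of `K ∩ B(0,r)` onto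
`Ω ∩ B(y,r)` has `f 0 = y` and derivative the identity at `0`. -/
def IsModelCone {n : ℕ} (Ω : Set (Euc n)) (y : Euc n) (K : Set (Euc n)) : Prop :=
  (∀ x ∈ K, ∀ a : ℝ, 0 < a → a • x ∈ K) ∧
  ∃ r : ℝ, 0 < r ∧ ∃ f f' : Euc n → Euc n,
    f 0 = y ∧ HasFDerivWithinAt f (ContinuousLinearMap.id ℝ (Euc n)) K 0 ∧
    ContDiffOn ℝ ∞ f (K ∩ ball 0 r) ∧ ContDiffOn ℝ ∞ f' (Ω ∩ ball y r) ∧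
    MapsTo f (K ∩ ball 0 r) (Ω ∩ ball y r) ∧ MapsTo f' (Ω ∩ ball y r) (K ∩ ball 0 r) ∧
    InvOn f' f (K ∩ ball 0 r) (Ω ∩ ball y r)

/-- The constant `C_y = -Λ(K_y; 1)` of a boundary point with model cone `K_y = K`. -/
def coneConst {n : ℕ} (K : Set (Euc n)) : EReal := -bottom K 1

/-- The cone `{z : z/|z| ∈ M}` with cross-section `M ⊆ S^{j-1}`. -/
def cone {j : ℕ} (M : Set (Sph j)) : Set (Euc j) :=
  {z | ∃ x ∈ M, ∃ t : ℝ, 0 < t ∧ z = t • (x : Euc j)}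

/-- The cone `ℝ^{m-j} × K'` in `ℝ^m`, where `A` identifies `ℝ^m` isometrically with
`ℝ^{m-j} × ℝ^j`. -/
def cylinder {m j : ℕ} (A : Euc m ≃ₗᵢ[ℝ] WithLp 2 (Euc (m - j) × Euc j)) (K' : Set (Euc j)) :
    Set (Euc m) :=
  {x | (A x).snd ∈ K'}

/-! ### Coordinates around a direction `θ` in the cross-section -/

section Section

variable {j : ℕ} (M : Set (Sph j)) (θ : Sph j)

/-- `P_θ = Π_θ ∩ ∂K`, where `Π_θ` is the hyperplane through `θ` orthogonal to `θ`. -/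
def sectionBdry : Set (Euc j) :=
  {z | ⟪z - (θ : Euc j), (θ : Euc j)⟫ = 0} ∩ frontier (cone M)

/-- The directions `θ ∈ M` for which `P_θ` is bounded. -/
def Admissible : Prop := θ ∈ M ∧ Bornology.IsBounded (sectionBdry M θ)

/-- The space `θ^⊥ ≅ ℝ^{j-1}` of the coordinates `η` on `Π_θ`. -/
abbrev Perp : Submodule ℝ (Euc j) := (ℝ ∙ (θ : Euc j))ᗮ

/-- The unit sphere `S^{j-2}` of `θ^⊥`. -/
abbrev SphPerp : Type := sphere (0 : Perp θ) 1

/-- The surface measure `dφ` on `S^{j-2}`. -/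
def sphMeasure : Measure (SphPerp θ) := (volume : Measure (Perp θ)).toSphere

/-- `b_θ(φ)`: the distance from `θ` to `P_θ` along the ray in direction `φ`. -/
def b (φ : Perp θ) : ℝ :=
  sInf {ρ : ℝ | 0 ≤ ρ ∧ (θ : Euc j) + ρ • (φ : Euc j) ∈ sectionBdry M θ}

/-- The extension of `b_θ` from `S^{j-2}` to `θ^⊥ \ {0}`, constant on rays. -/
def bExt (η : Perp θ) : ℝ := b M θ (‖η‖⁻¹ • η)

/-- The tangent space of `S^{j-2}` at `φ`, of dimension `j - 2`. -/
abbrev Tan (φ : SphPerp θ) : Submodule ℝ (Perp θ) := (ℝ ∙ (φ : Perp θ))ᗮ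

/-- `b_θ` is differentiable at `φ ∈ S^{j-2}`. -/
def BDiff (φ : SphPerp θ) : Prop := DifferentiableAt ℝ (bExt M θ) (φ : Perp θ)

/-- The gradient `∇_φ b_θ(φ)` on the unit sphere `S^{j-2}`. -/
def gradB (φ : SphPerp θ) : Tan θ φ :=
  (Tan θ φ).orthogonalProjectionOnto (gradient (bExt M θ) (φ : Perp θ))

/-- `ζ_θ(φ) = b ∇b`. -/
def zeta (φ : SphPerp θ) : Tan θ φ := b M θ φ • gradB M θ φ

/-- `Z_θ(φ) = b² I + ∇b ⊗ ∇b`. -/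
def Zop (φ : SphPerp θ) : Tan θ φ →L[ℝ] Tan θ φ :=
  b M θ φ ^ 2 • ContinuousLinearMap.id ℝ (Tan θ φ) +
    InnerProductSpace.rankOne ℝ (gradB M θ φ) (gradB M θ φ)

/-- `Ψ_θ(φ) = Z⁻¹ ζ`. -/
def Psi (φ : SphPerp θ) : Tan θ φ := (Zop M θ φ).inverse (zeta M θ φ)

/-- The area-element factor `Σ_θ(φ)`. -/
def Sig (φ : SphPerp θ) : ℝ :=
  Real.sqrt (1 + ((b M θ φ - ⟪Psi M θ φ, gradB M θ φ⟫) ^ 2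
    + b M θ φ ^ 2 * ‖Psi M θ φ‖ ^ 2)⁻¹)

/-- The weighted mean `∫ b_θ^{j-1} Σ_θ dφ / ∫ b_θ^{j-1} dφ`. -/
def meanSig : ℝ :=
  (∫ φ, b M θ φ ^ (j - 1) * Sig M θ φ ∂(sphMeasure θ)) / ∫ φ, b M θ φ ^ (j - 1) ∂(sphMeasure θ)

end Section

/-- The lower bound: `sup_θ` of the squared weighted mean of `Σ_θ`. -/
def lowerBound {j : ℕ} (M : Set (Sph j)) : EReal :=
  ⨆ (θ : Sph j) (_ : Admissible M θ), ((meanSig M θ ^ 2 : ℝ) : EReal)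

/-- The upper bound: `inf_θ sup_φ Σ_θ(φ)²`, where `φ` runs over the directions in which
`b_θ` is differentiable. -/
def upperBound {j : ℕ} (M : Set (Sph j)) : EReal :=
  ⨅ (θ : Sph j) (_ : Admissible M θ),
    ⨆ (φ : SphPerp θ) (_ : BDiff M θ φ), ((Sig M θ φ ^ 2 : ℝ) : EReal)

/-- `M` is the spherical polyhedron cut out by the open hemispheres with inner normals in the finite
set `N`, and the ball of spherical radius `r` about `θ` is inscribed in it: it lies in `M` and
touches every face. -/
structure HasInscribedBall {j : ℕ} (M : Set (Sph j)) (N : Finset (Euc j)) (θ : Sph j) (r : ℝ) :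
    Prop where
  polyhedron : M = {x : Sph j | ∀ n ∈ N, 0 < ⟪n, (x : Euc j)⟫}
  pos : 0 < r
  ball_subset : ∀ x : Sph j, InnerProductGeometry.angle (θ : Euc j) (x : Euc j) < r → x ∈ M
  touches : ∀ n ∈ N, ∃ p ∈ closure M, ⟪n, (p : Euc j)⟫ = 0 ∧
    InnerProductGeometry.angle (θ : Euc j) (p : Euc j) = r

end Robin

end

noncomputable section

open scoped NNReal ENNReal

namespace Robin

set_option linter.unusedSectionVars false

/-! ### The area formula for Lipschitz graphs -/

/-! For an admissible `θ` the slice of the cone by the hyperplane `Π_θ` is bounded, open and convex,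
and the cone is the epigraph `t > h(η)` over `θ^⊥` of the gauge `h` of that slice
(`Good.mem_cone_iff`). Here `h` is Lipschitz and homogeneous of degree one, and `h = 1 / b_θ` on
`S^{j-2}`. The expression `Σ_θ` is nothing but the area element `√(1 + |∇h|²)` of the graph
(`Good.sig_eq`), which is homogeneous of degree zero. The area formula
`IsGraphMap.restrict_range_eq` turns boundary integrals into integrals over the base.

Upper bound for `C_y`: if `Σ_θ ≤ S`, then on each line parallel to `θ` the inequality `S u(0)² ≤ ∫
(|u'|² + S² u²)` holds. Integrated over the base it gives `∫_∂K u² ≤ ∫_K |∇u|² + S² ∫_K u²`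
(`integral_bdry_sq_le`), hence `Λ ≥ -S²` after passing to traces.

Lower bound: the test function is `exp(-c t)`, with a decay of rate `ε` along the edge. As `ε → 0`
its Rayleigh quotient tends to `c² - 2cμ`, where `μ` is the mean of the area element with weight
`exp(-2c h)`. In polar coordinates this mean equals `∫ b^{j-1} Σ / ∫ b^{j-1}`, whatever `c` is
(`Good.meanSig_eq`), and `c = μ` gives `Λ ≤ -μ²`.

Exactness: if a ball of radius `r` about `θ` is inscribed in a polyhedral cross-section, all faces
are equally inclined to `θ`. So `Σ_θ` is the constant `1 / sin r`, and both bounds for this `θ`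
equal `1 / sin² r`. -/

theorem euclideanHausdorffMeasure_image_le_of_edist_le {X Y Z : Type*}
    [EMetricSpace Y] [MeasurableSpace Y] [BorelSpace Y]
    [EMetricSpace Z] [MeasurableSpace Z] [BorelSpace Z]
    (d : ℕ) {P : X → Y} {G : X → Z} {s : Set X} {K : ℝ≥0}
    (h : ∀ x ∈ s, ∀ y ∈ s, edist (G x) (G y) ≤ K * edist (P x) (P y)) :
    (Measure.euclideanHausdorffMeasure d : Measure Z) (G '' s) ≤
      (K : ℝ≥0∞) ^ d * (Measure.euclideanHausdorffMeasure d : Measure Y) (P '' s) := by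
  rcases s.eq_empty_or_nonempty with rfl | ⟨x₀, hx₀⟩
  · simp
  have : Nonempty X := ⟨x₀⟩
  -- `P` need not be injective: by hypothesis `G` is constant on the fibres of `P`, so any section
  -- `Q` of `P` makes `G ∘ Q` a `K`-Lipschitz map of `P '' s` onto `G '' s`.
  set Q := Function.invFunOn P s
  have hQ : ∀ x ∈ s, Q (P x) ∈ s ∧ P (Q (P x)) = P x := fun x hx =>
    ⟨Function.invFunOn_mem ⟨x, hx, rfl⟩, Function.invFunOn_eq ⟨x, hx, rfl⟩⟩
  have hGQ : ∀ x ∈ s, G (Q (P x)) = G x := by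
    intro x hx
    have h1 := h _ (hQ x hx).1 _ hx
    rw [(hQ x hx).2, edist_self, mul_zero] at h1
    exact edist_le_zero.1 h1
  have hL : LipschitzOnWith K (G ∘ Q) (P '' s) := by
    rintro _ ⟨x, hx, rfl⟩ _ ⟨y, hy, rfl⟩
    simp only [Function.comp_apply, hGQ x hx, hGQ y hy]
    exact h x hx y hy
  have himg : (G ∘ Q) '' (P '' s) = G '' s := by
    rw [image_image]
    exact image_congr fun x hx => hGQ x hx
  have h2 := hL.hausdorffMeasure_image_le (d := (d : ℝ)) (Nat.cast_nonneg d)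
  rw [himg, ENNReal.rpow_natCast] at h2
  rw [Measure.euclideanHausdorffMeasure_def, Measure.euclideanHausdorffMeasure_def,
    Measure.smul_apply, Measure.smul_apply, mul_smul_comm]
  gcongr

section Stretch

variable {W : Type*} [NormedAddCommGroup W] [InnerProductSpace ℝ W]

/-- The symmetric linear map with the same metric distortion as the graph map of `⟪a, ·⟫`. -/
def stretch (a : W) : W →ₗ[ℝ] W :=
  LinearMap.transvection (innerₛₗ ℝ a) ((1 + √(1 + ‖a‖ ^ 2))⁻¹ • a)

/-- With `q = √(1 + ‖a‖²)`, the map fixes `a^⊥` and multiplies `a` by `1 + ‖a‖² / (1 + q) = q`. The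
coefficient `(1 + q)⁻¹` is `(q - 1) / ‖a‖²` in a form that survives `a = 0`. -/
theorem norm_stretch_sq (a w : W) : ‖stretch a w‖ ^ 2 = ‖w‖ ^ 2 + ⟪a, w⟫ ^ 2 := by
  have h0 : 0 ≤ √(1 + ‖a‖ ^ 2) := Real.sqrt_nonneg _
  have h1 : √(1 + ‖a‖ ^ 2) ^ 2 = 1 + ‖a‖ ^ 2 := Real.sq_sqrt (by positivity)
  have h2 : stretch a w = w + (⟪a, w⟫ * (1 + √(1 + ‖a‖ ^ 2))⁻¹) • a := by
    simp [stretch, LinearMap.transvection.apply, smul_smul]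
  rw [h2, norm_add_sq_real, inner_smul_right, norm_smul, mul_pow, Real.norm_eq_abs, sq_abs,
    real_inner_comm a w]
  have h3 : ‖a‖ ^ 2 = √(1 + ‖a‖ ^ 2) ^ 2 - 1 := by linarith
  generalize √(1 + ‖a‖ ^ 2) = q at *
  rw [h3]
  have : 1 + q ≠ 0 := by positivity
  field_simp
  ring

theorem det_stretch [FiniteDimensional ℝ W] (a : W) :
    LinearMap.det (stretch a) = √(1 + ‖a‖ ^ 2) := by
  have h0 : 0 ≤ √(1 + ‖a‖ ^ 2) := Real.sqrt_nonneg _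
  have h1 : √(1 + ‖a‖ ^ 2) ^ 2 = 1 + ‖a‖ ^ 2 := Real.sq_sqrt (by positivity)
  rw [stretch, LinearMap.transvection.det]
  simp only [innerₛₗ_apply_apply, inner_smul_right, real_inner_self_eq_norm_sq]
  have h3 : ‖a‖ ^ 2 = √(1 + ‖a‖ ^ 2) ^ 2 - 1 := by linarith
  generalize √(1 + ‖a‖ ^ 2) = q at *
  rw [h3]
  have : 1 + q ≠ 0 := by positivity
  field_simp
  ring

end Stretch

/-- Triangle inequality in the plane: `(D, p)` is at distance at most `δ D`, hence at most `δ ‖(D,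
q)‖`, from `(D, q)`. -/
theorem sqrt_add_sq_le_mul_of_abs_sub_le {D p q δ : ℝ} (hδ : 0 ≤ δ)
    (h : |p - q| ≤ δ * D) : √(D ^ 2 + p ^ 2) ≤ (1 + δ) * √(D ^ 2 + q ^ 2) := by
  rw [Real.sqrt_le_left (by positivity), mul_pow, Real.sq_sqrt (by positivity)]
  have hp : |p| ≤ |q| + δ * D := by
    have := abs_sub_abs_le_abs_sub p q
    linarith
  have h1 : p ^ 2 ≤ (|q| + δ * D) ^ 2 := by
    rw [← sq_abs p]; gcongr
  have h2 : |q| ^ 2 = q ^ 2 := sq_abs q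
  nlinarith [mul_nonneg hδ (sq_nonneg (|q| - D)), (abs_nonneg (p - q)).trans h, abs_nonneg q,
    mul_nonneg (mul_nonneg hδ hδ) (sq_nonneg q)]

section Area

variable {W F : Type*} [NormedAddCommGroup W] [InnerProductSpace ℝ W] [FiniteDimensional ℝ W]
  [MeasurableSpace W] [BorelSpace W] [MetricSpace F] [MeasurableSpace F] [BorelSpace F]
  {H : W → ℝ} {G : W → F}

/-- `G` parametrises isometrically the graph of `H`. -/
def IsGraphMap (H : W → ℝ) (G : W → F) : Prop :=
  ∀ x y, dist (G x) (G y) = √(‖x - y‖ ^ 2 + (H x - H y) ^ 2)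

/-- The area element of the graph of `H`. -/
def areaElement (H : W → ℝ) (x : W) : ℝ := √(1 + ‖fderiv ℝ H x‖ ^ 2)

theorem areaElement_nonneg (x : W) : 0 ≤ areaElement H x := Real.sqrt_nonneg _

theorem one_le_areaElement (H : W → ℝ) (x : W) : 1 ≤ areaElement H x := by
  rw [areaElement, Real.one_le_sqrt]
  nlinarith [sq_nonneg ‖fderiv ℝ H x‖]

theorem areaElement_le {K : ℝ≥0} (hH : LipschitzWith K H) (x : W) :
    areaElement H x ≤ √(1 + K ^ 2) := by
  refine Real.sqrt_le_sqrt ?_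
  have := norm_fderiv_le_of_lipschitz ℝ hH (x₀ := x)
  gcongr

theorem norm_areaElement_le {K : ℝ≥0} (hH : LipschitzWith K H) (x : W) :
    ‖areaElement H x‖ ≤ √(1 + K ^ 2) := by
  rw [Real.norm_of_nonneg (areaElement_nonneg x)]
  exact areaElement_le hH x

theorem volume_image_stretch (a : W) (s : Set W) :
    volume (stretch a '' s) = ENNReal.ofReal √(1 + ‖a‖ ^ 2) * volume s := by
  rw [Measure.addHaar_image_linearMap, det_stretch, abs_of_nonneg (Real.sqrt_nonneg _)]

theorem dist_stretch (a x y : W) :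
    dist (stretch a x) (stretch a y) = √(‖x - y‖ ^ 2 + ⟪a, x - y⟫ ^ 2) := by
  rw [dist_eq_norm, ← map_sub, ← norm_stretch_sq, Real.sqrt_sq (norm_nonneg _)]

theorem edist_le_of_dist_le {X Y : Type*} [MetricSpace X] [MetricSpace Y] {x x' : X} {y y' : Y}
    {K : ℝ≥0} (h : dist x x' ≤ K * dist y y') : edist x x' ≤ K * edist y y' := by
  rw [edist_dist, edist_dist, ← ENNReal.ofReal_coe_nnreal,
    ← ENNReal.ofReal_mul (NNReal.coe_nonneg K)]
  exact ENNReal.ofReal_le_ofReal h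

/-- Where `H` is `δ`-close to the linear form `A = ⟪a, ·⟫`, distances on the graph and distances
after `stretch a` agree up to the factor `1 + δ`, both ways. The stretched set has known volume
because `det (stretch a) = √(1 + ‖a‖²)`. -/
theorem IsGraphMap.measure_image_approx (hG : IsGraphMap H G) {A : W →L[ℝ] ℝ} {δ : ℝ≥0}
    {s : Set W} (hA : ApproximatesLinearOn H A s δ) :
    (Measure.euclideanHausdorffMeasure (Module.finrank ℝ W) : Measure F) (G '' s) ≤
      ((1 + δ : ℝ≥0) : ℝ≥0∞) ^ (Module.finrank ℝ W) *
        (ENNReal.ofReal √(1 + ‖A‖ ^ 2) * volume s) ∧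
    ENNReal.ofReal √(1 + ‖A‖ ^ 2) * volume s ≤
      ((1 + δ : ℝ≥0) : ℝ≥0∞) ^ (Module.finrank ℝ W) *
        (Measure.euclideanHausdorffMeasure (Module.finrank ℝ W) : Measure F) (G '' s) := by
  set a : W := (InnerProductSpace.toDual ℝ W).symm A with ha
  have hna : ‖a‖ = ‖A‖ := by simp [ha]
  have hin : ∀ w, ⟪a, w⟫ = A w := fun w => InnerProductSpace.toDual_symm_apply
  have key : ∀ x ∈ s, ∀ y ∈ s, |(H x - H y) - ⟪a, x - y⟫| ≤ δ * ‖x - y‖ := by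
    intro x hx y hy
    rw [hin]
    exact hA x hx y hy
  rw [← hna, ← volume_image_stretch, ← InnerProductSpace.euclideanHausdorffMeasure_eq_volume]
  constructor
  · refine euclideanHausdorffMeasure_image_le_of_edist_le _ fun x hx y hy =>
      edist_le_of_dist_le ?_
    rw [hG, dist_stretch]
    exact sqrt_add_sq_le_mul_of_abs_sub_le δ.2 (key x hx y hy)
  · refine euclideanHausdorffMeasure_image_le_of_edist_le _ fun x hx y hy =>
      edist_le_of_dist_le ?_
    rw [hG, dist_stretch]
    refine sqrt_add_sq_le_mul_of_abs_sub_le δ.2 ?_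
    rw [abs_sub_comm]
    exact key x hx y hy

theorem ApproximatesLinearOn_norm_fderiv_sub_le {A : W →L[ℝ] ℝ} {δ : ℝ≥0} {s : Set W}
    (hA : ApproximatesLinearOn H A s δ) (hs : MeasurableSet s)
    (hd : ∀ x ∈ s, DifferentiableAt ℝ H x) :
    ∀ᵐ x ∂(volume.restrict s), ‖fderiv ℝ H x - A‖ ≤ δ := by
  rcases subsingleton_or_nontrivial W with hW | hW
  · refine Eventually.of_forall fun x => ?_
    rw [Subsingleton.elim (fderiv ℝ H x - A) 0, norm_zero]
    exact δ.2
  -- Multiplication by a unit vector turns the scalar function into a map `W → W` without changing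
  -- norms, so that `ApproximatesLinearOn.norm_fderiv_sub_le` applies.
  obtain ⟨e, he⟩ := exists_norm_eq W zero_le_one
  have h1 : ApproximatesLinearOn (fun x => H x • e) (A.smulRight e) s δ := by
    intro x hx y hy
    have := hA x hx y hy
    simp only [ContinuousLinearMap.smulRight_apply]
    rw [← sub_smul, ← sub_smul, norm_smul, he, mul_one]
    exact this
  have h2 := h1.norm_fderiv_sub_le volume hs (fun x => (fderiv ℝ H x).smulRight e)
    (fun x hx => ((hd x hx).hasFDerivAt.smul_const e).hasFDerivWithinAt)
  filter_upwards [h2] with x hx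
  have h3 : (fderiv ℝ H x).smulRight e - A.smulRight e = (fderiv ℝ H x - A).smulRight e := by
    ext w; simp [sub_smul]
  rw [h3, ← NNReal.coe_le_coe, coe_nnnorm, ContinuousLinearMap.norm_smulRight_apply, he,
    mul_one] at hx
  exact hx

theorem sqrt_one_add_sq_le_mul {a b δ : ℝ} (hδ : 0 ≤ δ) (h : |a - b| ≤ δ) :
    √(1 + a ^ 2) ≤ (1 + δ) * √(1 + b ^ 2) := by
  simpa using sqrt_add_sq_le_mul_of_abs_sub_le (D := 1) hδ (by simpa using h)

theorem areaElement_le_of_approx {A : W →L[ℝ] ℝ} {δ : ℝ≥0} {x : W}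
    (h : ‖fderiv ℝ H x - A‖ ≤ δ) :
    ENNReal.ofReal (areaElement H x) ≤
        ((1 + δ : ℝ≥0) : ℝ≥0∞) * ENNReal.ofReal √(1 + ‖A‖ ^ 2) ∧
      ENNReal.ofReal √(1 + ‖A‖ ^ 2) ≤
        ((1 + δ : ℝ≥0) : ℝ≥0∞) * ENNReal.ofReal (areaElement H x) := by
  have h1 : |‖fderiv ℝ H x‖ - ‖A‖| ≤ δ := (abs_norm_sub_norm_le _ _).trans h
  rw [← ENNReal.ofReal_coe_nnreal, ← ENNReal.ofReal_mul (NNReal.coe_nonneg _),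
    ← ENNReal.ofReal_mul (NNReal.coe_nonneg _)]
  constructor
  · exact ENNReal.ofReal_le_ofReal (sqrt_one_add_sq_le_mul δ.2 h1)
  · exact ENNReal.ofReal_le_ofReal (sqrt_one_add_sq_le_mul δ.2 (by rwa [abs_sub_comm]))

theorem measurable_areaElement : Measurable (areaElement H) := by
  unfold areaElement
  have := measurable_fderiv ℝ H
  fun_prop

theorem IsGraphMap.lipschitz (hG : IsGraphMap H G) {K : ℝ≥0} (hH : LipschitzWith K H) :
    LipschitzWith (1 + K) G := by
  refine LipschitzWith.of_dist_le_mul fun x y => ?_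
  rw [hG, Real.sqrt_le_left (by positivity)]
  have h1 : |H x - H y| ≤ K * ‖x - y‖ := by
    have := hH.dist_le_mul x y
    rwa [Real.dist_eq, dist_eq_norm] at this
  have h2 : (H x - H y) ^ 2 ≤ (K * ‖x - y‖) ^ 2 := by
    rw [← sq_abs (H x - H y)]; gcongr
  rw [dist_eq_norm, NNReal.coe_add, NNReal.coe_one]
  nlinarith [mul_nonneg K.2 (sq_nonneg ‖x - y‖)]

theorem IsGraphMap.injective (hG : IsGraphMap H G) : Function.Injective G := by
  intro x y hxy
  have h := hG x y
  rw [hxy, dist_self, eq_comm, Real.sqrt_eq_zero (by positivity)] at h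
  have : ‖x - y‖ ^ 2 = 0 := by nlinarith [sq_nonneg (H x - H y), sq_nonneg ‖x - y‖]
  simpa [sub_eq_zero] using this

theorem IsGraphMap.measurableEmbedding (hG : IsGraphMap H G) {K : ℝ≥0}
    (hH : LipschitzWith K H) : MeasurableEmbedding G :=
  (hG.lipschitz hH).continuous.measurableEmbedding hG.injective

/-- By Rademacher the non-differentiability set is null, also for the pulled-back measure since `G`
is Lipschitz. The rest splits into countably many pieces on which `H` is `δ`-linear. On each piece
the measures cost `d` factors `1 + δ` and the area element one more. -/
theorem IsGraphMap.comap_le (hG : IsGraphMap H G) {K : ℝ≥0} (hH : LipschitzWith K H)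
    {δ : ℝ≥0} (hδ : δ ≠ 0) {s : Set W} (hs : MeasurableSet s) :
    (Measure.comap G (Measure.euclideanHausdorffMeasure (Module.finrank ℝ W) : Measure F)) s ≤
      ((1 + δ : ℝ≥0) : ℝ≥0∞) ^ (Module.finrank ℝ W + 1) *
        (volume.withDensity fun x => ENNReal.ofReal (areaElement H x)) s ∧
    (volume.withDensity fun x => ENNReal.ofReal (areaElement H x)) s ≤
      ((1 + δ : ℝ≥0) : ℝ≥0∞) ^ (Module.finrank ℝ W + 1) *
      (Measure.comap G (Measure.euclideanHausdorffMeasure (Module.finrank ℝ W) : Measure F)) s := by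
  set d := Module.finrank ℝ W
  set ν := Measure.comap G (Measure.euclideanHausdorffMeasure d : Measure F) with hν
  set ρ := (volume : Measure W).withDensity fun x => ENNReal.ofReal (areaElement H x) with hρ
  have hemb := hG.measurableEmbedding hH
  have hνapp : ∀ t, ν t = (Measure.euclideanHausdorffMeasure d : Measure F) (G '' t) :=
    fun t => hemb.comap_apply _ t
  set D : Set W := {x | DifferentiableAt ℝ H x}
  have hD : MeasurableSet D := measurableSet_of_differentiableAt ℝ H
  have hDnull : volume Dᶜ = 0 := hH.ae_differentiableAt
  have hνac : ν Dᶜ = 0 := by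
    have h1 := euclideanHausdorffMeasure_image_le_of_edist_le d (P := (id : W → W)) (G := G)
      (s := Dᶜ) (K := 1 + K) (fun x _ y _ => hG.lipschitz hH x y)
    rw [image_id, InnerProductSpace.euclideanHausdorffMeasure_eq_volume, hDnull, mul_zero] at h1
    rw [hνapp]
    exact le_antisymm h1 bot_le
  have hρac : ρ Dᶜ = 0 := withDensity_absolutelyContinuous _ _ hDnull
  obtain ⟨t, A, tdisj, tmeas, tcover, tA, -⟩ :=
    exists_partition_approximatesLinearOn_of_hasFDerivWithinAt H D (fderiv ℝ H)
      (fun x hx => (DifferentiableAt.hasFDerivAt hx).hasFDerivWithinAt) (fun _ => δ)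
      (fun _ => hδ)
  have hsplit : ∀ κ : Measure W, κ Dᶜ = 0 → κ s = ∑' n, κ (s ∩ (D ∩ t n)) := by
    intro κ hκ
    have h1 : κ s = κ (s ∩ D) := by
      refine le_antisymm ?_ (measure_mono inter_subset_left)
      calc κ s ≤ κ ((s ∩ D) ∪ Dᶜ) := measure_mono fun x hx => by
            by_cases hxD : x ∈ D
            · exact Or.inl ⟨hx, hxD⟩
            · exact Or.inr hxD
        _ ≤ κ (s ∩ D) + κ Dᶜ := measure_union_le _ _
        _ = κ (s ∩ D) := by rw [hκ, add_zero]
    have h2 : s ∩ D = ⋃ n, s ∩ (D ∩ t n) := by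
      rw [← inter_iUnion, ← inter_iUnion, inter_eq_left.2 tcover]
    rw [h1, h2, measure_iUnion]
    · intro i k hik
      exact (tdisj hik).mono (fun x hx => hx.2.2) (fun x hx => hx.2.2)
    · exact fun n => hs.inter (hD.inter (tmeas n))
  have hpiece : ∀ n, ν (s ∩ (D ∩ t n)) ≤ ((1 + δ : ℝ≥0) : ℝ≥0∞) ^ (d + 1) * ρ (s ∩ (D ∩ t n)) ∧
      ρ (s ∩ (D ∩ t n)) ≤ ((1 + δ : ℝ≥0) : ℝ≥0∞) ^ (d + 1) * ν (s ∩ (D ∩ t n)) := by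
    intro n
    set p := s ∩ (D ∩ t n)
    have hp : MeasurableSet p := hs.inter (hD.inter (tmeas n))
    have hAp : ApproximatesLinearOn H (A n) p δ := (tA n).mono_set inter_subset_right
    have h1 := hG.measure_image_approx hAp
    have h2 := ApproximatesLinearOn_norm_fderiv_sub_le hAp hp (fun x hx => hx.2.1)
    have hc : ENNReal.ofReal √(1 + ‖A n‖ ^ 2) * volume p
        = ∫⁻ _ in p, ENNReal.ofReal √(1 + ‖A n‖ ^ 2) := by simp
    have h3 : ENNReal.ofReal √(1 + ‖A n‖ ^ 2) * volume p ≤ ((1 + δ : ℝ≥0) : ℝ≥0∞) * ρ p := by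
      rw [hρ, withDensity_apply _ hp, hc, ← lintegral_const_mul' _ _ ENNReal.coe_ne_top]
      refine lintegral_mono_ae ?_
      filter_upwards [h2] with x hx
      exact (areaElement_le_of_approx hx).2
    have h4 : ρ p ≤ ((1 + δ : ℝ≥0) : ℝ≥0∞) * (ENNReal.ofReal √(1 + ‖A n‖ ^ 2) * volume p) := by
      rw [hρ, withDensity_apply _ hp, hc, ← lintegral_const_mul' _ _ ENNReal.coe_ne_top]
      refine lintegral_mono_ae ?_
      filter_upwards [h2] with x hx
      exact (areaElement_le_of_approx hx).1
    rw [hνapp]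
    constructor
    · rw [pow_succ, mul_assoc]
      refine h1.1.trans ?_
      gcongr
    · rw [pow_succ', mul_assoc]
      exact h4.trans (mul_le_mul' le_rfl h1.2)
  rw [hsplit ν hνac, hsplit ρ hρac, ← ENNReal.tsum_mul_left, ← ENNReal.tsum_mul_left]
  exact ⟨ENNReal.tsum_le_tsum fun n => (hpiece n).1, ENNReal.tsum_le_tsum fun n => (hpiece n).2⟩

theorem ennreal_le_of_forall_le_one_add_pow_mul {x y : ℝ≥0∞} (d : ℕ)
    (h : ∀ δ : ℝ≥0, δ ≠ 0 → x ≤ ((1 + δ : ℝ≥0) : ℝ≥0∞) ^ d * y) : x ≤ y := by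
  have h1 : Tendsto (fun δ : ℝ≥0 => ((1 + δ : ℝ≥0) : ℝ≥0∞) ^ d * y) (𝓝[≠] 0)
      (𝓝 (1 * y)) := by
    refine ENNReal.Tendsto.mul_const ?_ (Or.inl one_ne_zero)
    have h2 : Continuous fun δ : ℝ≥0 => (((1 + δ) ^ d : ℝ≥0) : ℝ≥0∞) := by fun_prop
    have h3 := (h2.tendsto 0).mono_left (nhdsWithin_le_nhds (s := {0}ᶜ))
    simpa using h3
  rw [one_mul] at h1
  exact ge_of_tendsto h1 (eventually_mem_nhdsWithin.mono fun δ hδ => h δ hδ)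

/-- The area formula for the graph of a Lipschitz function. -/
theorem IsGraphMap.restrict_range_eq (hG : IsGraphMap H G) {K : ℝ≥0} (hH : LipschitzWith K H) :
    (Measure.euclideanHausdorffMeasure (Module.finrank ℝ W) : Measure F).restrict (range G) =
      (volume.withDensity fun x => ENNReal.ofReal (areaElement H x)).map G := by
  have hemb := hG.measurableEmbedding hH
  rw [← hemb.map_comap]
  congr 1
  ext s hs
  exact le_antisymm
    (ennreal_le_of_forall_le_one_add_pow_mul _ fun δ hδ => (hG.comap_le hH hδ hs).1)
    (ennreal_le_of_forall_le_one_add_pow_mul _ fun δ hδ => (hG.comap_le hH hδ hs).2)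

end Area

/-! ### Geometry of the cone -/

/-- Since `g` grows at unit rate along `v`, every zero of `g` is a limit of points where `g` is
positive. -/
theorem frontier_setOf_pos_eq {X : Type*} [NormedAddCommGroup X] [NormedSpace ℝ X] {g : X → ℝ}
    (hg : Continuous g) {v : X} (hv : ∀ z s, g (z + s • v) = g z + s) :
    frontier {z | 0 < g z} = {z | g z = 0} := by
  have hopen : IsOpen {z | 0 < g z} := isOpen_lt continuous_const hg
  ext z
  rw [hopen.frontier_eq]
  constructor
  · rintro ⟨h1, h2⟩
    have h3 : 0 ≤ g z := closure_lt_subset_le continuous_const hg h1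
    exact le_antisymm (not_lt.1 h2) h3
  · intro hz
    have hz' : g z = 0 := hz
    refine ⟨?_, fun h => (show 0 < g z from h).ne' hz'⟩
    have h1 : Tendsto (fun s : ℝ => z + s • v) (𝓝[>] 0) (𝓝 (z + (0 : ℝ) • v)) := by
      refine Tendsto.mono_left ?_ nhdsWithin_le_nhds
      exact Continuous.tendsto (by fun_prop) 0
    rw [zero_smul, add_zero] at h1
    refine mem_closure_of_tendsto h1 (eventually_mem_nhdsWithin.mono fun s hs => ?_)
    have hs' : (0 : ℝ) < s := hs
    simpa [hv, hz'] using hs'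

section Cone

variable {j : ℕ} {M : Set (Sph j)}

theorem smul_mem_cone {z : Euc j} (hz : z ∈ cone M) {t : ℝ} (ht : 0 < t) : t • z ∈ cone M := by
  obtain ⟨x, hx, s, hs, rfl⟩ := hz
  exact ⟨x, hx, t * s, mul_pos ht hs, by rw [smul_smul]⟩

theorem smul_mem_cone_iff {z : Euc j} {t : ℝ} (ht : 0 < t) : t • z ∈ cone M ↔ z ∈ cone M := by
  refine ⟨fun h => ?_, fun h => smul_mem_cone h ht⟩
  have := smul_mem_cone h (inv_pos.2 ht)
  rwa [smul_smul, inv_mul_cancel₀ ht.ne', one_smul] at this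

theorem coe_mem_cone {x : Sph j} (hx : x ∈ M) : (x : Euc j) ∈ cone M :=
  ⟨x, hx, 1, one_pos, (one_smul _ _).symm⟩

theorem zero_notMem_cone : (0 : Euc j) ∉ cone M := by
  rintro ⟨x, -, t, ht, h⟩
  have h1 := congrArg norm h
  rw [norm_zero, norm_smul, norm_eq_of_mem_sphere x, mul_one, Real.norm_eq_abs] at h1
  exact ht.ne' (abs_eq_zero.1 h1.symm)

theorem add_mem_cone (hconv : Convex ℝ (cone M)) {z w : Euc j} (hz : z ∈ cone M)
    (hw : w ∈ cone M) : z + w ∈ cone M := by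
  have h1 := hconv hz hw (a := 1 / 2) (b := 1 / 2) (by norm_num) (by norm_num) (by norm_num)
  rw [← smul_add] at h1
  exact (smul_mem_cone_iff (by norm_num)).1 h1

theorem isOpen_cone (hM : IsOpen M) : IsOpen (cone M) := by
  obtain ⟨O, hO, rfl⟩ := isOpen_induced_iff.1 hM
  have h1 : cone (Subtype.val ⁻¹' O : Set (Sph j)) =
      {z | z ≠ 0} ∩ (fun z : Euc j => ‖z‖⁻¹ • z) ⁻¹' O := by
    ext z
    constructor
    · rintro ⟨x, hx, t, ht, rfl⟩
      have hxn : ‖(x : Euc j)‖ = 1 := norm_eq_of_mem_sphere x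
      refine ⟨smul_ne_zero ht.ne' (ne_of_apply_ne norm (by simp [hxn])), ?_⟩
      simp only [mem_preimage, norm_smul, hxn, Real.norm_eq_abs, abs_of_pos ht, mul_one,
        smul_smul, inv_mul_cancel₀ ht.ne', one_smul]
      exact hx
    · rintro ⟨hz, hzO⟩
      have hn : 0 < ‖z‖ := norm_pos_iff.2 hz
      refine ⟨⟨‖z‖⁻¹ • z, ?_⟩, hzO, ‖z‖, hn, ?_⟩
      · rw [mem_sphere_zero_iff_norm, norm_smul, norm_inv, norm_norm, inv_mul_cancel₀ hn.ne']
      · simp [smul_smul, hn.ne']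
  rw [h1]
  refine ContinuousOn.isOpen_inter_preimage ?_ isOpen_ne hO
  refine ContinuousOn.smul (ContinuousOn.inv₀ continuous_norm.continuousOn ?_) continuousOn_id
  exact fun z hz => norm_ne_zero_iff.2 hz

/-- By compactness `⟪e, ·⟫` attains a positive minimum on `closure M`, which serves as `δ`. -/
theorem exists_pos_mul_norm_le_inner {e : Euc j} (he : ∀ x ∈ closure M, 0 < ⟪e, (x : Euc j)⟫) :
    ∃ δ : ℝ, 0 < δ ∧ ∀ z ∈ cone M, δ * ‖z‖ ≤ ⟪e, z⟫ := by
  rcases (closure M).eq_empty_or_nonempty with h0 | hne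
  · refine ⟨1, one_pos, ?_⟩
    rintro z ⟨x, hx, -⟩
    exact absurd (subset_closure hx) (by simp [h0])
  obtain ⟨x₀, hx₀, hmin⟩ := (isClosed_closure (s := M)).isCompact.exists_isMinOn hne
    (f := fun x : Sph j => ⟪e, (x : Euc j)⟫) (by fun_prop)
  refine ⟨_, he x₀ hx₀, ?_⟩
  rintro z ⟨x, hx, t, ht, rfl⟩
  have h1 : ⟪e, (x₀ : Euc j)⟫ ≤ ⟪e, (x : Euc j)⟫ := hmin (subset_closure hx)
  rw [norm_smul, norm_eq_of_mem_sphere x, mul_one, Real.norm_eq_abs, abs_of_pos ht,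
    inner_smul_right, mul_comm]
  gcongr

/-- The pole of the given hemisphere may lie outside the cone. If the cone missed the open convex
set `D` of uniformly positive functionals, a functional `f = ⟪a, ·⟫` would separate them,
nonpositive on the cone and nonnegative on `D`. Then `-a + ε e₀ ∈ D` for all `ε > 0`, so `f (-a) ≥
0`, that is `a = 0`, contradicting strict separation. -/
theorem exists_mem_cone_forall_closure_pos (hM : IsOpen M) (hconv : Convex ℝ (cone M))
    (hne : M.Nonempty) (hhemi : ∃ e : Euc j, ∀ x ∈ closure M, 0 < ⟪e, (x : Euc j)⟫) :
    ∃ e ∈ cone M, ∀ x ∈ closure M, 0 < ⟪e, (x : Euc j)⟫ := by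
  -- The uniform `δ`, rather than mere positivity on the cone, is what makes `D` open.
  set D : Set (Euc j) := {e | ∃ δ : ℝ, 0 < δ ∧ ∀ z ∈ cone M, δ * ‖z‖ ≤ ⟪e, z⟫} with hD
  have hDpos : ∀ e ∈ D, ∀ x ∈ closure M, 0 < ⟪e, (x : Euc j)⟫ := by
    rintro e ⟨δ, hδ, h⟩ x hx
    have h1 : closure M ⊆ {x : Sph j | δ ≤ ⟪e, (x : Euc j)⟫} := by
      refine closure_minimal (fun x hx => ?_) (isClosed_le continuous_const (by fun_prop))
      have := h _ (coe_mem_cone hx)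
      rwa [norm_eq_of_mem_sphere x, mul_one] at this
    exact hδ.trans_le (h1 hx)
  obtain ⟨e₀, he₀⟩ := hhemi
  have he₀D : e₀ ∈ D := exists_pos_mul_norm_le_inner he₀
  have hDconv : Convex ℝ D := by
    rintro e ⟨δ, hδ, h⟩ e' ⟨δ', hδ', h'⟩ a b ha hb hab
    refine ⟨a * δ + b * δ', ?_, fun z hz => ?_⟩
    · rcases ha.eq_or_lt with rfl | ha
      · rw [zero_add] at hab; subst hab; simpa using hδ'
      · positivity
    · rw [inner_add_left, inner_smul_left, inner_smul_left]
      simp only [conj_trivial]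
      nlinarith [mul_le_mul_of_nonneg_left (h z hz) ha, mul_le_mul_of_nonneg_left (h' z hz) hb]
  have hDopen : IsOpen D := by
    rw [Metric.isOpen_iff]
    rintro e ⟨δ, hδ, h⟩
    refine ⟨δ / 2, by positivity, fun e' he' => ⟨δ / 2, by positivity, fun z hz => ?_⟩⟩
    rw [mem_ball, dist_eq_norm] at he'
    have h1 : |⟪e' - e, z⟫| ≤ ‖e' - e‖ * ‖z‖ := abs_real_inner_le_norm _ _
    have h2 : ⟪e', z⟫ = ⟪e, z⟫ + ⟪e' - e, z⟫ := by rw [inner_sub_left]; ring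
    have h3 := h z hz
    have h4 := neg_abs_le ⟪e' - e, z⟫
    nlinarith [mul_le_mul_of_nonneg_right he'.le (norm_nonneg z)]
  by_contra hcon
  push Not at hcon
  have hdisj : Disjoint (cone M) D := by
    rw [Set.disjoint_left]
    intro e he heD
    obtain ⟨x, hx, h⟩ := hcon e he
    exact absurd (hDpos e heD x hx) (not_lt.2 h)
  obtain ⟨f, u, hf, hf'⟩ := geometric_hahn_banach_open_open hconv (isOpen_cone hM) hDconv
    hDopen hdisj
  set a : Euc j := (InnerProductSpace.toDual ℝ (Euc j)).symm f with ha
  have hin : ∀ w, ⟪a, w⟫ = f w := fun w => InnerProductSpace.toDual_symm_apply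
  have hDsmul : ∀ e ∈ D, ∀ t : ℝ, 0 < t → t • e ∈ D := by
    rintro e ⟨δ, hδ, h⟩ t ht
    refine ⟨t * δ, by positivity, fun z hz => ?_⟩
    rw [inner_smul_left, conj_trivial, mul_assoc]
    exact mul_le_mul_of_nonneg_left (h z hz) ht.le
  have hlin : ∀ {p q : ℝ}, (∀ t : ℝ, 0 < t → t * p < q) → p ≤ 0 := by
    intro p q h
    by_contra hp
    push Not at hp
    have h1 := h ((|q| + 1) / p) (by positivity)
    rw [div_mul_cancel₀ _ hp.ne'] at h1
    linarith [le_abs_self q]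
  have hnp : ∀ z ∈ cone M, f z ≤ 0 := by
    intro z hz
    refine hlin (q := u) fun t ht => ?_
    simpa using hf _ (smul_mem_cone hz ht)
  have hnn : ∀ e ∈ D, 0 ≤ f e := by
    intro e he
    have : -f e ≤ 0 := by
      refine hlin (q := -u) fun t ht => ?_
      have := hf' _ (hDsmul e he t ht)
      rw [map_smul, smul_eq_mul] at this
      linarith
    linarith
  have hDa : ∀ ε : ℝ, 0 < ε → -a + ε • e₀ ∈ D := by
    obtain ⟨δ, hδ, h⟩ := he₀D
    refine fun ε hε => ⟨ε * δ, by positivity, fun z hz => ?_⟩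
    rw [inner_add_left, inner_neg_left, inner_smul_left, conj_trivial, hin]
    have := mul_le_mul_of_nonneg_left (h z hz) hε.le
    linarith [hnp z hz]
  have ha0 : ‖a‖ ^ 2 ≤ 0 := by
    have h1 : ∀ ε : ℝ, 0 < ε → ‖a‖ ^ 2 ≤ ε * f e₀ := by
      intro ε hε
      have h1 := hnn _ (hDa ε hε)
      rw [map_add, map_neg, map_smul, smul_eq_mul, ← hin a, real_inner_self_eq_norm_sq] at h1
      linarith
    have h2 : Tendsto (fun ε : ℝ => ε * f e₀) (𝓝[>] 0) (𝓝 (0 * f e₀)) :=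
      Tendsto.mono_left (Continuous.tendsto (by fun_prop) 0) nhdsWithin_le_nhds
    rw [zero_mul] at h2
    exact ge_of_tendsto h2 (eventually_mem_nhdsWithin.mono fun ε hε => h1 ε hε)
  have ha1 : a = 0 := by
    have : ‖a‖ = 0 := by nlinarith [norm_nonneg a]
    simpa using this
  obtain ⟨x, hx⟩ := hne
  have h1 := hf _ (coe_mem_cone hx)
  have h2 := hf' _ he₀D
  rw [← hin, ha1, inner_zero_left] at h1 h2
  linarith

/-- A direction `θ` of the cone at acute angle to all of `closure M` works: `δ ‖z‖ ≤ ⟪θ, z⟫` on the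
closed cone, while `⟪θ, z⟫ = 1` on `Π_θ`. -/
theorem exists_admissible (hM : IsOpen M) (hconv : Convex ℝ (cone M))
    (hne : M.Nonempty) (hhemi : ∃ e : Euc j, ∀ x ∈ closure M, 0 < ⟪e, (x : Euc j)⟫) :
    ∃ θ, Admissible M θ := by
  obtain ⟨e, ⟨θ, hθ, t, ht, rfl⟩, hpos⟩ := exists_mem_cone_forall_closure_pos hM hconv hne hhemi
  have hpos' : ∀ x ∈ closure M, 0 < ⟪(θ : Euc j), (x : Euc j)⟫ := by
    intro x hx
    have := hpos x hx
    rw [inner_smul_left, conj_trivial] at this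
    exact pos_of_mul_pos_right this ht.le
  obtain ⟨δ, hδ, h⟩ := exists_pos_mul_norm_le_inner hpos'
  refine ⟨θ, hθ, ?_⟩
  refine (Metric.isBounded_closedBall (x := (0 : Euc j)) (r := 1 / δ)).subset ?_
  rintro z ⟨hz1, hz2⟩
  have hcl : closure (cone M) ⊆ {z | δ * ‖z‖ ≤ ⟪(θ : Euc j), z⟫} :=
    closure_minimal (fun z hz => h z hz) (isClosed_le (by fun_prop) (by fun_prop))
  have h2 : δ * ‖z‖ ≤ ⟪(θ : Euc j), z⟫ := hcl (frontier_subset_closure hz2)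
  have h3 : ⟪z - (θ : Euc j), (θ : Euc j)⟫ = 0 := hz1
  rw [inner_sub_left, real_inner_self_eq_norm_sq, norm_eq_of_mem_sphere θ, real_inner_comm] at h3
  rw [mem_closedBall_zero_iff, le_div_iff₀ hδ]
  linarith

end Cone

/-! ### The cone as the epigraph of the gauge of a slice -/

section Slice

variable {j : ℕ} (M : Set (Sph j)) (θ : Sph j)

/-- The section `{η ∈ θ^⊥ : θ + η ∈ K}` of the cone `K` over `M`. -/
def slice : Set (Perp θ) := {η | (θ : Euc j) + (η : Euc j) ∈ cone M}

/-- The function on `θ^⊥` whose epigraph is the cone over `M`. -/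
def profile : Perp θ → ℝ := gauge (slice M θ)

variable {M θ}

theorem inner_perp (η : Perp θ) : ⟪(θ : Euc j), (η : Euc j)⟫ = 0 :=
  Submodule.mem_orthogonal_singleton_iff_inner_right.1 η.2

theorem proj_perp_add_inner_smul (z : Euc j) :
    ((Perp θ).orthogonalProjectionOnto z : Euc j) + ⟪(θ : Euc j), z⟫ • (θ : Euc j) = z := by
  rw [Submodule.coe_orthogonalProjectionOnto_apply, Submodule.starProjection_orthogonal_val,
    Submodule.starProjection_unit_singleton ℝ (norm_eq_of_mem_sphere θ), sub_add_cancel]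

theorem isOpen_slice (hM : IsOpen M) : IsOpen (slice M θ) :=
  (isOpen_cone hM).preimage (by fun_prop)

theorem convex_slice (hconv : Convex ℝ (cone M)) : Convex ℝ (slice M θ) := by
  intro x hx y hy a b ha hb hab
  have h1 := hconv hx hy ha hb hab
  have h2 : a • ((θ : Euc j) + (x : Euc j)) + b • ((θ : Euc j) + (y : Euc j)) =
      (θ : Euc j) + ((a • x + b • y : Perp θ) : Euc j) := by
    have h3 : (θ : Euc j) = a • (θ : Euc j) + b • (θ : Euc j) := by
      rw [← add_smul, hab, one_smul]
    push_cast
    nth_rewrite 3 [h3]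
    module
  rw [h2] at h1
  exact h1

theorem zero_mem_slice (hθ : θ ∈ M) : (0 : Perp θ) ∈ slice M θ := by
  simpa [slice] using coe_mem_cone hθ

theorem finrank_perp : Module.finrank ℝ (Perp θ) = j - 1 := by
  have h0 : (θ : Euc j) ≠ 0 := ne_of_apply_ne norm (by simp)
  have h1 : Module.finrank ℝ (ℝ ∙ (θ : Euc j)) + Module.finrank ℝ (Perp θ) =
      Module.finrank ℝ (Euc j) := (ℝ ∙ (θ : Euc j)).finrank_add_finrank_orthogonal
  rw [finrank_span_singleton h0, finrank_euclideanSpace_fin] at h1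
  omega

/-- Admissibility only bounds the boundary of the slice; a priori the slice could be the outside.
Spheres in `θ^⊥` are connected, as its dimension is at least 2. So a large sphere through a point
`η` of the slice, missing the boundary, lies in the slice and contains `-η`. Adding the hemisphere
inequalities at `θ + η` and `θ - η` bounds `‖η‖`. -/
theorem isBounded_slice (hj : 3 ≤ j) (hM : IsOpen M)
    (hhemi : ∃ e : Euc j, ∀ x ∈ closure M, 0 < ⟪e, (x : Euc j)⟫) (hθ : Admissible M θ) :
    Bornology.IsBounded (slice M θ) := by
  obtain ⟨e, he⟩ := hhemi
  obtain ⟨δ, hδ, h⟩ := exists_pos_mul_norm_le_inner he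
  obtain ⟨R, hR⟩ := hθ.2.subset_closedBall 0
  have hrank : 1 < Module.rank ℝ (Perp θ) := by
    rw [← Module.finrank_eq_rank, finrank_perp]
    exact_mod_cast (by omega : 1 < j - 1)
  have hθn : ‖(θ : Euc j)‖ = 1 := norm_eq_of_mem_sphere θ
  -- `R + 1` allows for the unit shift from `θ + ξ` to `ξ`; the other entry is the bound obtained
  -- from `η` and `-η` together.
  set R' := max (R + 1) (⟪e, (θ : Euc j)⟫ / δ)
  refine (Metric.isBounded_closedBall (x := (0 : Perp θ)) (r := R')).subset fun η hη => ?_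
  rw [mem_closedBall_zero_iff]
  by_contra hlt
  push Not at hlt
  have hneg : -η ∈ slice M θ := by
    by_contra hnot
    have hpre := isPreconnected_sphere hrank (0 : Perp θ) ‖η‖
    obtain ⟨ξ, hξ1, hξ2⟩ : ∃ ξ ∈ sphere (0 : Perp θ) ‖η‖, ξ ∈ frontier (slice M θ) := by
      by_contra hno
      push Not at hno
      have hcl : ∀ ξ ∈ sphere (0 : Perp θ) ‖η‖, ξ ∈ closure (slice M θ) → ξ ∈ slice M θ := by
        intro ξ hξ h1
        by_contra h2
        exact hno ξ hξ ((isOpen_slice hM).frontier_eq ▸ ⟨h1, h2⟩)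
      obtain ⟨ξ, -, h1, h2⟩ := hpre _ _ (isOpen_slice (θ := θ) hM) isClosed_closure.isOpen_compl
        (fun ξ hξ => (em (ξ ∈ slice M θ)).imp id fun h1 h2 => h1 (hcl ξ hξ h2))
        ⟨η, by simp, hη⟩ ⟨-η, by simp, fun h1 => hnot (hcl _ (by simp) h1)⟩
      exact h2 (subset_closure h1)
    have hξ3 : (θ : Euc j) + (ξ : Euc j) ∈ sectionBdry M θ := by
      refine ⟨?_, ?_⟩
      · simp only [mem_ofPred_eq, add_sub_cancel_left]
        rw [real_inner_comm]
        exact inner_perp ξ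
      · rw [(isOpen_slice hM).frontier_eq] at hξ2
        rw [(isOpen_cone hM).frontier_eq]
        refine ⟨?_, hξ2.2⟩
        have hc : Continuous fun ξ : Perp θ => (θ : Euc j) + (ξ : Euc j) := by fun_prop
        exact hc.closure_preimage_subset _ hξ2.1
    have h1 := hR hξ3
    rw [mem_closedBall_zero_iff] at h1
    have h2 : ‖(ξ : Euc j)‖ = ‖η‖ := by simpa using hξ1
    have h3 : ‖(ξ : Euc j)‖ ≤ ‖(θ : Euc j) + (ξ : Euc j)‖ + ‖(θ : Euc j)‖ := by
      simpa using norm_sub_le ((θ : Euc j) + (ξ : Euc j)) (θ : Euc j)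
    have h4 : R + 1 < ‖η‖ := (le_max_left _ _).trans_lt hlt
    linarith
  have hle : ∀ ξ : Perp θ, ξ ∈ slice M θ → δ * ‖ξ‖ ≤ ⟪e, (θ : Euc j)⟫ + ⟪e, (ξ : Euc j)⟫ := by
    intro ξ hξ
    have h1 := h _ hξ
    rw [inner_add_right] at h1
    have h2 : ‖(ξ : Euc j)‖ ≤ ‖(θ : Euc j) + (ξ : Euc j)‖ := by
      have h3 := norm_add_sq_real (θ : Euc j) (ξ : Euc j)
      rw [inner_perp] at h3
      nlinarith [norm_nonneg (ξ : Euc j), norm_nonneg ((θ : Euc j) + (ξ : Euc j))]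
    have h3 : ‖ξ‖ = ‖(ξ : Euc j)‖ := rfl
    rw [h3]
    nlinarith
  have h1 := hle _ hη
  have h2 := hle _ hneg
  rw [norm_neg, Submodule.coe_neg, inner_neg_right] at h2
  have h3 : ⟪e, (θ : Euc j)⟫ / δ < ‖η‖ := (le_max_right _ _).trans_lt hlt
  rw [div_lt_iff₀ hδ] at h3
  linarith

/-- The standing properties of the cone and the direction. -/
structure Good (M : Set (Sph j)) (θ : Sph j) : Prop where
  isOpen : IsOpen M
  convex : Convex ℝ (cone M)
  mem : θ ∈ M
  bounded : Bornology.IsBounded (slice M θ)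
  two_le : 2 ≤ j

namespace Good

theorem absorbent (h : Good M θ) : Absorbent ℝ (slice M θ) :=
  absorbent_nhds_zero ((isOpen_slice h.isOpen).mem_nhds (zero_mem_slice h.mem))

theorem exists_lipschitz (h : Good M θ) : ∃ K, LipschitzWith K (profile M θ) :=
  (convex_slice h.convex).lipschitz_gauge
    ((isOpen_slice h.isOpen).mem_nhds (zero_mem_slice h.mem))

theorem continuous (h : Good M θ) : Continuous (profile M θ) :=
  h.exists_lipschitz.choose_spec.continuous

theorem profile_smul {t : ℝ} (ht : 0 ≤ t) (η : Perp θ) :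
    profile M θ (t • η) = t * profile M θ η := by
  rw [profile, gauge_smul_of_nonneg ht, smul_eq_mul]

theorem exists_pos_mul_norm_le (h : Good M θ) :
    ∃ κ : ℝ, 0 < κ ∧ ∀ η, κ * ‖η‖ ≤ profile M θ η := by
  obtain ⟨R, hR0, hR⟩ := h.bounded.subset_ball_lt 0 0
  refine ⟨R⁻¹, inv_pos.2 hR0, fun η => ?_⟩
  have h1 := le_gauge_of_subset_closedBall h.absorbent hR0.le
    (hR.trans ball_subset_closedBall) (x := η)
  rwa [inv_mul_eq_div]

theorem profile_pos (h : Good M θ) {η : Perp θ} (hη : η ≠ 0) : 0 < profile M θ η := by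
  obtain ⟨κ, hκ, hle⟩ := h.exists_pos_mul_norm_le
  exact (mul_pos hκ (norm_pos_iff.2 hη)).trans_le (hle η)

theorem mem_slice_iff (h : Good M θ) (η : Perp θ) : η ∈ slice M θ ↔ profile M θ η < 1 := by
  conv_lhs => rw [← setOfPred_gauge_lt_one_eq_self_of_isOpen (convex_slice h.convex)
    (zero_mem_slice h.mem) (isOpen_slice h.isOpen)]
  rfl

theorem mem_cone_iff_of_pos (h : Good M θ) (η : Perp θ) {t : ℝ} (ht : 0 < t) :
    (η : Euc j) + t • (θ : Euc j) ∈ cone M ↔ profile M θ η < t := by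
  have h1 : (η : Euc j) + t • (θ : Euc j) = t • ((θ : Euc j) + ((t⁻¹ • η : Perp θ) : Euc j)) := by
    rw [Submodule.coe_smul, smul_add, smul_smul, mul_inv_cancel₀ ht.ne', one_smul, add_comm]
  rw [h1, smul_mem_cone_iff ht]
  change t⁻¹ • η ∈ slice M θ ↔ _
  rw [h.mem_slice_iff, profile_smul (inv_pos.2 ht).le, inv_mul_lt_iff₀ ht, mul_one]

/-- For `t ≤ 0` both sides fail. If `η + tθ` were in the cone, adding multiples of `θ` would give
`profile η < s` for all `s > 0`, so `η = 0`, and then the cone would contain the origin. -/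
theorem mem_cone_iff (h : Good M θ) (η : Perp θ) (t : ℝ) :
    (η : Euc j) + t • (θ : Euc j) ∈ cone M ↔ profile M θ η < t := by
  rcases lt_or_ge 0 t with ht | ht
  · exact h.mem_cone_iff_of_pos η ht
  have h0 : 0 ≤ profile M θ η := gauge_nonneg _
  refine ⟨fun hmem => ?_, fun hlt => absurd hlt (by linarith)⟩
  exfalso
  have hup : ∀ s : ℝ, t < s → (η : Euc j) + s • (θ : Euc j) ∈ cone M := by
    intro s hs
    have := add_mem_cone h.convex hmem
      (smul_mem_cone (coe_mem_cone h.mem) (sub_pos.2 hs))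
    rwa [add_assoc, ← add_smul, add_sub_cancel] at this
  have hle : profile M θ η ≤ 0 := by
    refine le_of_forall_gt_imp_ge_of_dense fun s hs => ?_
    exact ((h.mem_cone_iff_of_pos η hs).1 (hup s (ht.trans_lt hs))).le
  have hη : η = 0 := by
    by_contra hη
    exact absurd (h.profile_pos hη) (not_lt.2 hle)
  have : (0 : Euc j) ∈ cone M := by
    rcases ht.eq_or_lt with rfl | ht
    · simpa [hη] using hmem
    · simpa using hup 0 ht |> fun h => by simpa [hη] using h
  exact zero_notMem_cone this

end Good

theorem good_of_admissible (hj : 3 ≤ j) (hM : IsOpen M) (hconv : Convex ℝ (cone M))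
    (hhemi : ∃ e : Euc j, ∀ x ∈ closure M, 0 < ⟪e, (x : Euc j)⟫) (hθ : Admissible M θ) :
    Good M θ :=
  ⟨hM, hconv, hθ.1, isBounded_slice hj hM hhemi hθ, by omega⟩

theorem Good.frontier_cone (h : Good M θ) (η : Perp θ) (t : ℝ) :
    (η : Euc j) + t • (θ : Euc j) ∈ frontier (cone M) ↔ profile M θ η = t := by
  set P : Euc j → Perp θ := fun z => (Perp θ).orthogonalProjectionOnto z with hP
  have hθn : ⟪(θ : Euc j), (θ : Euc j)⟫ = 1 := by
    rw [real_inner_self_eq_norm_sq, norm_eq_of_mem_sphere θ]; norm_num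
  have hPθ : P (θ : Euc j) = 0 :=
    Submodule.orthogonalProjectionOnto_apply_of_mem_orthogonal
      (Submodule.le_orthogonal_orthogonal _ (Submodule.mem_span_singleton_self _))
  have hdec : ∀ z, z = (P z : Euc j) + ⟪(θ : Euc j), z⟫ • (θ : Euc j) :=
    fun z => (proj_perp_add_inner_smul z).symm
  have hcone : cone M = {z | 0 < ⟪(θ : Euc j), z⟫ - profile M θ (P z)} := by
    ext z
    conv_lhs => rw [hdec z]
    rw [h.mem_cone_iff]
    simp
  have hc : Continuous fun z => ⟪(θ : Euc j), z⟫ - profile M θ (P z) := by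
    have := h.continuous
    fun_prop
  rw [hcone, frontier_setOf_pos_eq hc (v := (θ : Euc j))]
  · simp only [mem_ofPred_eq, inner_add_right, inner_smul_right, hθn, inner_perp]
    have : P ((η : Euc j) + t • (θ : Euc j)) = η := by
      simp only [hP] at hPθ ⊢
      rw [map_add, map_smul, hPθ]
      simp
    rw [this]
    constructor <;> intro h <;> linarith
  · intro z s
    have : P (z + s • (θ : Euc j)) = P z := by
      simp only [hP] at hPθ ⊢
      rw [map_add, map_smul, hPθ]
      simp
    rw [this, inner_add_right, inner_smul_right, hθn]
    ring

end Slice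

/-! ### The radial function `b_θ` and the identification of `Σ_θ` with the area element -/

section Radial

variable {j : ℕ} {M : Set (Sph j)} {θ : Sph j}

namespace Good

theorem add_smul_mem_sectionBdry_iff (h : Good M θ) (η : Perp θ) :
    (θ : Euc j) + (η : Euc j) ∈ sectionBdry M θ ↔ profile M θ η = 1 := by
  have h1 : (θ : Euc j) + (η : Euc j) = (η : Euc j) + (1 : ℝ) • (θ : Euc j) := by
    rw [one_smul, add_comm]
  rw [← h.frontier_cone η 1, ← h1]
  refine ⟨fun hz => hz.2, fun hz => ⟨?_, hz⟩⟩
  simp only [mem_ofPred_eq, add_sub_cancel_left]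
  rw [real_inner_comm]
  exact inner_perp η

/-- The profile is linear along a ray and positive away from the origin, so it takes the value 1
exactly once and the infimum runs over a singleton. -/
theorem b_eq (h : Good M θ) {φ : Perp θ} (hφ : φ ≠ 0) : b M θ φ = (profile M θ φ)⁻¹ := by
  have hp := h.profile_pos hφ
  have h1 : {ρ : ℝ | 0 ≤ ρ ∧ (θ : Euc j) + ρ • (φ : Euc j) ∈ sectionBdry M θ} =
      {(profile M θ φ)⁻¹} := by
    ext ρ
    simp only [mem_ofPred_eq, mem_singleton_iff]
    rw [← Submodule.coe_smul, h.add_smul_mem_sectionBdry_iff]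
    constructor
    · rintro ⟨h0, h1⟩
      rw [profile_smul h0] at h1
      exact eq_inv_of_mul_eq_one_left h1
    · rintro rfl
      refine ⟨(inv_pos.2 hp).le, ?_⟩
      rw [profile_smul (inv_pos.2 hp).le, inv_mul_cancel₀ hp.ne']
  rw [b, h1, csInf_singleton]

theorem sphPerp_ne_zero (φ : SphPerp θ) : (φ : Perp θ) ≠ 0 :=
  ne_of_apply_ne norm (by simp)

theorem b_sph_eq (h : Good M θ) (φ : SphPerp θ) : b M θ φ = (profile M θ φ)⁻¹ :=
  h.b_eq (sphPerp_ne_zero φ)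

theorem b_pos (h : Good M θ) (φ : SphPerp θ) : 0 < b M θ φ := by
  rw [h.b_sph_eq]
  exact inv_pos.2 (h.profile_pos (sphPerp_ne_zero φ))

theorem sectionBdry_eq (h : Good M θ) : sectionBdry M θ =
    {z | ∃ φ : SphPerp θ, z = (θ : Euc j) + b M θ φ • ((φ : Perp θ) : Euc j)} := by
  ext z
  constructor
  · intro hz
    have h1 : ⟪z - (θ : Euc j), (θ : Euc j)⟫ = 0 := hz.1
    obtain ⟨η, rfl⟩ : ∃ η : Perp θ, z = (θ : Euc j) + (η : Euc j) := by
      refine ⟨⟨z - θ, ?_⟩, by simp⟩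
      rw [Submodule.mem_orthogonal_singleton_iff_inner_right, real_inner_comm]
      exact h1
    have h2 := (h.add_smul_mem_sectionBdry_iff η).1 hz
    have hη : η ≠ 0 := by
      rintro rfl
      simp [profile] at h2
    have hn : 0 < ‖η‖ := norm_pos_iff.2 hη
    refine ⟨⟨‖η‖⁻¹ • η, by
      rw [mem_sphere_zero_iff_norm, norm_smul, norm_inv, norm_norm, inv_mul_cancel₀ hn.ne']⟩, ?_⟩
    rw [h.b_sph_eq, profile_smul (inv_pos.2 hn).le, h2, mul_one, inv_inv, Submodule.coe_smul,
      smul_smul, mul_inv_cancel₀ hn.ne', one_smul]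
  · rintro ⟨φ, rfl⟩
    rw [← Submodule.coe_smul, h.add_smul_mem_sectionBdry_iff, profile_smul (h.b_pos φ).le,
      h.b_sph_eq, inv_mul_cancel₀ (h.profile_pos (sphPerp_ne_zero φ)).ne']

theorem bExt_eq (h : Good M θ) {η : Perp θ} (hη : η ≠ 0) :
    bExt M θ η = ‖η‖ / profile M θ η := by
  have hn : 0 < ‖η‖ := norm_pos_iff.2 hη
  rw [bExt, h.b_eq (smul_ne_zero (inv_ne_zero hn.ne') hη), profile_smul (inv_pos.2 hn).le,
    mul_inv, inv_inv, div_eq_mul_inv]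

theorem profile_eq (h : Good M θ) {η : Perp θ} (hη : η ≠ 0) :
    profile M θ η = ‖η‖ / bExt M θ η := by
  rw [h.bExt_eq hη, div_div_cancel₀ (norm_pos_iff.2 hη).ne']

theorem bExt_pos (h : Good M θ) {η : Perp θ} (hη : η ≠ 0) : 0 < bExt M θ η := by
  rw [h.bExt_eq hη]
  exact div_pos (norm_pos_iff.2 hη) (h.profile_pos hη)

theorem bExt_sph (φ : SphPerp θ) : bExt M θ φ = b M θ φ := by
  simp [bExt]

theorem bDiff_iff (h : Good M θ) (φ : SphPerp θ) :
    BDiff M θ φ ↔ DifferentiableAt ℝ (profile M θ) φ := by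
  have h0 := sphPerp_ne_zero φ
  have hn : DifferentiableAt ℝ (fun η : Perp θ => ‖η‖) φ := differentiableAt_id.norm ℝ h0
  have hev : ∀ᶠ η : Perp θ in 𝓝 (φ : Perp θ), η ≠ 0 := isOpen_ne.mem_nhds h0
  constructor
  · intro hd
    have hd' : DifferentiableAt ℝ (bExt M θ) φ := hd
    refine (hn.mul (hd'.inv (h.bExt_pos h0).ne')).congr_of_eventuallyEq ?_
    filter_upwards [hev] with η hη using h.profile_eq hη
  · intro hd
    refine (hn.mul (hd.inv (h.profile_pos h0).ne')).congr_of_eventuallyEq ?_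
    filter_upwards [hev] with η hη using h.bExt_eq hη

/-- `bExt` is constant on rays, so its gradient is tangential and the projection in `gradB` changes
nothing. -/
theorem inner_gradient_bExt (φ : SphPerp θ) (hd : BDiff M θ φ) :
    ⟪(φ : Perp θ), gradient (bExt M θ) φ⟫ = 0 := by
  have h1 : HasDerivAt (fun t : ℝ => bExt M θ (t • (φ : Perp θ)))
      (fderiv ℝ (bExt M θ) φ φ) 1 := by
    have h2 : HasDerivAt (fun t : ℝ => t • (φ : Perp θ)) ((1 : ℝ) • (φ : Perp θ)) 1 :=
      (hasDerivAt_id (1 : ℝ)).smul_const _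
    rw [one_smul] at h2
    have h3 : HasFDerivAt (bExt M θ) (fderiv ℝ (bExt M θ) φ) ((1 : ℝ) • (φ : Perp θ)) := by
      rw [one_smul]; exact DifferentiableAt.hasFDerivAt hd
    exact HasFDerivAt.comp_hasDerivAt (f := fun t : ℝ => t • (φ : Perp θ)) 1 h3 h2
  have h2 : HasDerivAt (fun t : ℝ => bExt M θ (t • (φ : Perp θ))) 0 1 := by
    refine (hasDerivAt_const (1 : ℝ) (bExt M θ φ)).congr_of_eventuallyEq ?_
    filter_upwards [lt_mem_nhds one_pos] with t ht
    have hφ : ‖(φ : Perp θ)‖ = 1 := norm_eq_of_mem_sphere φ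
    simp only [bExt, norm_smul, hφ, Real.norm_eq_abs, abs_of_pos ht, mul_one, smul_smul,
      inv_mul_cancel₀ ht.ne', inv_one]
  rw [real_inner_comm, inner_gradient_left]
  exact h1.unique h2

theorem coe_gradB (φ : SphPerp θ) (hd : BDiff M θ φ) :
    (gradB M θ φ : Perp θ) = gradient (bExt M θ) φ := by
  have h1 : gradient (bExt M θ) φ ∈ Tan θ φ :=
    Submodule.mem_orthogonal_singleton_iff_inner_right.2 (inner_gradient_bExt φ hd)
  rw [gradB, Submodule.coe_orthogonalProjectionOnto_apply]
  exact Submodule.starProjection_eq_self_iff.2 h1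

/-- Differentiating `h = ‖η‖ / bExt η` at a unit vector gives `∇h = φ / b - ∇b / b²`, a sum of two
orthogonal vectors. -/
theorem norm_fderiv_profile_sq (h : Good M θ) (φ : SphPerp θ) (hd : BDiff M θ φ) :
    ‖fderiv ℝ (profile M θ) φ‖ ^ 2 =
      (b M θ φ ^ 2 + ‖gradB M θ φ‖ ^ 2) / b M θ φ ^ 4 := by
  have h0 := sphPerp_ne_zero φ
  have hφ : ‖(φ : Perp θ)‖ = 1 := norm_eq_of_mem_sphere φ
  have hb := h.b_pos φ
  set g := gradient (bExt M θ) φ with hg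
  have hgn : ‖gradB M θ φ‖ = ‖g‖ := by
    rw [hg, ← coe_gradB φ hd]; rfl
  have hB : HasFDerivAt (bExt M θ) (innerSL ℝ g) φ :=
    (DifferentiableAt.hasGradientAt hd).hasFDerivAt
  have hN : HasFDerivAt (fun η : Perp θ => ‖η‖) (innerSL ℝ (φ : Perp θ)) φ := by
    have h1 : HasFDerivAt (fun η : Perp θ => √(‖η‖ ^ 2)) _ φ :=
      (hasStrictFDerivAt_norm_sq (φ : Perp θ)).hasFDerivAt.sqrt (by simp [hφ])
    have h2 : (fun η : Perp θ => √(‖η‖ ^ 2)) = fun η => ‖η‖ := by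
      ext η; exact Real.sqrt_sq (norm_nonneg _)
    rw [h2] at h1
    refine h1.congr_fderiv ?_
    ext w
    simp [hφ]
  have hP : HasFDerivAt (profile M θ)
      (innerSL ℝ ((b M θ φ)⁻¹ • (φ : Perp θ) - ((b M θ φ) ^ 2)⁻¹ • g)) φ := by
    have h1 := hN.mul ((hasDerivAt_inv (h.bExt_pos h0).ne').comp_hasFDerivAt _ hB)
    have hev : ∀ᶠ η : Perp θ in 𝓝 (φ : Perp θ), η ≠ 0 := isOpen_ne.mem_nhds h0
    refine (h1.congr_of_eventuallyEq (hev.mono fun η hη => h.profile_eq hη)).congr_fderiv ?_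
    ext w
    simp [bExt_sph, hφ]
    ring
  have hfd : ‖fderiv ℝ (profile M θ) φ‖ =
      ‖(b M θ φ)⁻¹ • (φ : Perp θ) - ((b M θ φ) ^ 2)⁻¹ • g‖ := by
    rw [hP.fderiv, innerSL_apply_norm]
  rw [hfd, norm_sub_sq_real, hgn, norm_smul, norm_smul, inner_smul_left, inner_smul_right,
    inner_gradient_bExt φ hd, hφ, Real.norm_of_nonneg (inv_pos.2 hb).le,
    Real.norm_of_nonneg (inv_pos.2 (pow_pos hb 2)).le]
  simp only [mul_zero, sub_zero, mul_one]
  field_simp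

/-- `∇b` is an eigenvector of `Z` with eigenvalue `b² + |∇b|²`, when it is nonzero. -/
theorem psi_eq (h : Good M θ) (φ : SphPerp θ) :
    Psi M θ φ = (b M θ φ / (b M θ φ ^ 2 + ‖gradB M θ φ‖ ^ 2)) • gradB M θ φ := by
  have hb := h.b_pos φ
  set g := gradB M θ φ with hg
  set β := b M θ φ with hβ
  have happ : ∀ x, Zop M θ φ x = β ^ 2 • x + ⟪g, x⟫ • g := by
    intro x
    simp [Zop, ← hg, ← hβ]
  -- `ContinuousLinearMap.inverse` is zero on non-invertible maps, so invertibility must be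
  -- established: `Z` is positive definite because `b > 0`.
  have hinj : Function.Injective (Zop M θ φ : Tan θ φ →ₗ[ℝ] Tan θ φ) := by
    rw [injective_iff_map_eq_zero]
    intro x hx
    have h1 : ⟪Zop M θ φ x, x⟫ = 0 := by
      rw [show Zop M θ φ x = 0 from hx, inner_zero_left]
    rw [happ, inner_add_left, inner_smul_left, inner_smul_left, real_inner_self_eq_norm_sq] at h1
    simp only [conj_trivial] at h1
    have h2 : β ^ 2 * ‖x‖ ^ 2 = 0 := by
      nlinarith [mul_nonneg (sq_nonneg β) (sq_nonneg ‖x‖), mul_self_nonneg ⟪g, x⟫]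
    have h3 : ‖x‖ ^ 2 = 0 := (mul_eq_zero.1 h2).resolve_left (by positivity)
    simpa using h3
  set e := (LinearEquiv.ofInjectiveEndo _ hinj).toContinuousLinearEquiv with he
  have hee : (e : Tan θ φ →L[ℝ] Tan θ φ) = Zop M θ φ := by
    ext x; rfl
  have hpos : 0 < β ^ 2 + ‖g‖ ^ 2 := by positivity
  rw [Psi, ← hee, ContinuousLinearMap.inverse_equiv]
  change e.symm _ = _
  rw [ContinuousLinearEquiv.symm_apply_eq]
  change _ = Zop M θ φ _
  rw [happ, zeta, ← hg, ← hβ, inner_smul_right, real_inner_self_eq_norm_sq, smul_smul, ← add_smul]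
  congr 1
  field_simp

/-- With `Q = b² + |∇b|²` and `Ψ = (b / Q) ∇b`, the bracket `(b - Ψ·∇b)² + b² |Ψ|²` equals `b⁴ / Q`,
the reciprocal of `|∇h|²`. -/
theorem sig_eq (h : Good M θ) (φ : SphPerp θ) (hd : BDiff M θ φ) :
    Sig M θ φ = areaElement (profile M θ) φ := by
  have hb := h.b_pos φ
  rw [Sig, areaElement, h.norm_fderiv_profile_sq φ hd, h.psi_eq φ]
  set g := gradB M θ φ
  set β := b M θ φ
  have hpos : 0 < β ^ 2 + ‖g‖ ^ 2 := by positivity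
  congr 2
  rw [inner_smul_left, conj_trivial, real_inner_self_eq_norm_sq, norm_smul, Real.norm_of_nonneg
    (by positivity), inv_eq_iff_eq_inv]
  field_simp
  ring

end Good

end Radial

/-! ### Polar coordinates and the weighted mean of `Σ_θ` -/

section Polar

theorem lintegral_eq_lintegral_sphere {E : Type*} [NormedAddCommGroup E] [InnerProductSpace ℝ E]
    [FiniteDimensional ℝ E] [MeasurableSpace E] [BorelSpace E] [Nontrivial E]
    {f : E → ℝ≥0∞} (hf : Measurable f) :
    ∫⁻ x, f x = ∫⁻ φ : sphere (0 : E) 1, (∫⁻ r in Ioi (0 : ℝ),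
      ENNReal.ofReal (r ^ (Module.finrank ℝ E - 1)) * f (r • (φ : E))) ∂(volume.toSphere) := by
  have h1 : ∫⁻ x, f x = ∫⁻ x : ({0}ᶜ : Set E), f x ∂(Measure.comap Subtype.val volume) := by
    rw [lintegral_subtype_comap (measurableSet_singleton _).compl, restrict_compl_singleton]
  have h2 := (volume : Measure E).measurePreserving_homeomorphUnitSphereProd.lintegral_comp_emb
    (Homeomorph.measurableEmbedding _) (fun p => f ((p.2 : ℝ) • (p.1 : E)))
  have h3 : ∀ x : ({0}ᶜ : Set E), f x =
      f (((homeomorphUnitSphereProd E x).2 : ℝ) • ((homeomorphUnitSphereProd E x).1 : E)) := by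
    intro x
    have hx : ‖(x : E)‖ ≠ 0 := norm_ne_zero_iff.2 x.2
    simp [smul_smul, hx]
  rw [h1, lintegral_congr h3, h2, lintegral_prod _ (by fun_prop)]
  refine lintegral_congr fun φ => ?_
  rw [Measure.volumeIoiPow, lintegral_withDensity_eq_lintegral_mul _ (by fun_prop) (by fun_prop)]
  exact lintegral_subtype_comap measurableSet_Ioi
    (fun r : ℝ => ENNReal.ofReal (r ^ (Module.finrank ℝ E - 1)) * f (r • (φ : E)))

theorem lintegral_pow_mul_exp (d : ℕ) (hd : 1 ≤ d) {a : ℝ} (ha : 0 < a) :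
    ∫⁻ r in Ioi (0 : ℝ), ENNReal.ofReal (r ^ (d - 1) * Real.exp (-(a * r))) =
      ENNReal.ofReal ((1 / a) ^ d * Real.Gamma d) := by
  have h1 := Real.integral_rpow_mul_exp_neg_mul_Ioi (a := d) (by exact_mod_cast hd) ha
  have h2 : ∫ r in Ioi (0 : ℝ), r ^ (d - 1) * Real.exp (-(a * r)) =
      (1 / a) ^ d * Real.Gamma d := by
    rw [← Real.rpow_natCast (1 / a) d, ← h1]
    refine setIntegral_congr_fun measurableSet_Ioi fun r _ => ?_
    rw [← Real.rpow_natCast, Nat.cast_sub hd, Nat.cast_one]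
  have hpos : 0 < (1 / a) ^ d * Real.Gamma d := by
    have : 0 < Real.Gamma d := Real.Gamma_pos_of_pos (by exact_mod_cast hd)
    positivity
  rw [← h2, ofReal_integral_eq_lintegral_ofReal]
  -- A non-integrable function would have Bochner integral 0, but the known value is positive.
  · by_contra hni
    rw [integral_undef hni] at h2
    exact hpos.ne h2
  · filter_upwards [ae_restrict_mem measurableSet_Ioi] with r hr
    have : (0 : ℝ) < r := hr
    positivity

end Polar

section SphereIntegrals

variable {j : ℕ} {M : Set (Sph j)} {θ : Sph j}

namespace Good

theorem nontrivial (h : Good M θ) : Nontrivial (Perp θ) := by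
  have h1 := h.two_le
  exact Module.nontrivial_of_finrank_pos (R := ℝ) (by rw [finrank_perp]; omega)

theorem hasFDerivAt_profile_smul {η : Perp θ} {L : Perp θ →L[ℝ] ℝ} {r : ℝ}
    (hr : 0 < r) (hL : HasFDerivAt (profile M θ) L η) : HasFDerivAt (profile M θ) L (r • η) := by
  have h1 : HasFDerivAt (fun x : Perp θ => r⁻¹ • x) (r⁻¹ • ContinuousLinearMap.id ℝ (Perp θ))
      (r • η) := (hasFDerivAt_id _).const_smul r⁻¹
  have h2 : HasFDerivAt (profile M θ) L (r⁻¹ • r • η) := by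
    rwa [smul_smul, inv_mul_cancel₀ hr.ne', one_smul]
  have h3 := (HasFDerivAt.comp (r • η) h2 h1).const_mul r
  have h4 : (fun x => r * (profile M θ ∘ fun x : Perp θ => r⁻¹ • x) x) = profile M θ := by
    ext x
    simp only [Function.comp_apply]
    rw [profile_smul (inv_pos.2 hr).le, mul_inv_cancel_left₀ hr.ne']
  rw [h4] at h3
  refine h3.congr_fderiv ?_
  ext w
  simp [hr.ne']

theorem hasFDerivAt_profile_smul_iff {η : Perp θ} {L : Perp θ →L[ℝ] ℝ} {r : ℝ} (hr : 0 < r) :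
    HasFDerivAt (profile M θ) L (r • η) ↔ HasFDerivAt (profile M θ) L η := by
  refine ⟨fun h => ?_, hasFDerivAt_profile_smul hr⟩
  have := hasFDerivAt_profile_smul (inv_pos.2 hr) h
  rwa [smul_smul, inv_mul_cancel₀ hr.ne', one_smul] at this

theorem areaElement_profile_smul (η : Perp θ) {r : ℝ} (hr : 0 < r) :
    areaElement (profile M θ) (r • η) = areaElement (profile M θ) η := by
  unfold areaElement
  by_cases hd : DifferentiableAt ℝ (profile M θ) η
  · rw [(hasFDerivAt_profile_smul hr hd.hasFDerivAt).fderiv]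
  -- Homogeneity persists at bad points: differentiability fails at both, and `fderiv` is 0 there by
  -- default.
  · have hd' : ¬ DifferentiableAt ℝ (profile M θ) (r • η) := fun ⟨L, hL⟩ =>
      hd ⟨L, (hasFDerivAt_profile_smul_iff hr).1 hL⟩
    rw [fderiv_zero_of_not_differentiableAt hd, fderiv_zero_of_not_differentiableAt hd']

/-- The sphere measure of a set is a multiple of the volume of the truncated cone over it. Over the
bad directions this cone consists of points where the profile is not differentiable, a null set by
Rademacher. -/
theorem ae_bDiff (h : Good M θ) : ∀ᵐ φ ∂(sphMeasure θ), BDiff M θ φ := by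
  obtain ⟨K, hK⟩ := h.exists_lipschitz
  have h1 : volume {η : Perp θ | ¬ DifferentiableAt ℝ (profile M θ) η} = 0 :=
    hK.ae_differentiableAt
  have hmeas : MeasurableSet {φ : SphPerp θ | ¬ DifferentiableAt ℝ (profile M θ) (φ : Perp θ)} :=
    (measurableSet_of_differentiableAt ℝ (profile M θ)).compl.preimage measurable_subtype_coe
  have h2 : {φ : SphPerp θ | ¬ BDiff M θ φ} =
      {φ : SphPerp θ | ¬ DifferentiableAt ℝ (profile M θ) (φ : Perp θ)} := by
    ext φ
    exact not_congr (h.bDiff_iff φ)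
  rw [ae_iff, h2, sphMeasure, Measure.toSphere_apply' _ hmeas]
  refine mul_eq_zero_of_right _ (measure_mono_null ?_ h1)
  rintro _ ⟨r, hr, _, ⟨φ, hφ, rfl⟩, rfl⟩ ⟨L, hL⟩
  exact hφ ⟨L, (hasFDerivAt_profile_smul_iff hr.1).1 hL⟩

theorem measurable_b (h : Good M θ) : Measurable fun φ : SphPerp θ => b M θ φ := by
  have h1 : (fun φ : SphPerp θ => b M θ φ) = fun φ : SphPerp θ => (profile M θ φ)⁻¹ :=
    funext h.b_sph_eq
  rw [h1]
  exact (h.continuous.measurable.comp measurable_subtype_coe).inv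

theorem exists_b_le (h : Good M θ) : ∃ C, ∀ φ : SphPerp θ, b M θ φ ≤ C := by
  obtain ⟨κ, hκ, hle⟩ := h.exists_pos_mul_norm_le
  refine ⟨κ⁻¹, fun φ => ?_⟩
  rw [h.b_sph_eq]
  have h1 := hle φ
  rw [norm_eq_of_mem_sphere φ, mul_one] at h1
  gcongr

theorem ae_sig_eq (h : Good M θ) :
    ∀ᵐ φ : SphPerp θ ∂(sphMeasure θ), Sig M θ φ = areaElement (profile M θ) φ := by
  filter_upwards [h.ae_bDiff] with φ hφ using h.sig_eq φ hφ

instance : IsFiniteMeasure (sphMeasure θ) := by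
  unfold sphMeasure; infer_instance

theorem integrable_b_pow (h : Good M θ) (d : ℕ) :
    Integrable (fun φ : SphPerp θ => b M θ φ ^ d) (sphMeasure θ) := by
  obtain ⟨C, hC⟩ := h.exists_b_le
  refine Integrable.of_bound (h.measurable_b.pow_const d).aestronglyMeasurable (C ^ d)
    (Eventually.of_forall fun φ => ?_)
  rw [Real.norm_of_nonneg (pow_nonneg (h.b_pos φ).le d)]
  exact pow_le_pow_left₀ (h.b_pos φ).le (hC φ) d

theorem integrable_b_pow_mul_area (h : Good M θ) (d : ℕ) :
    Integrable (fun φ : SphPerp θ => b M θ φ ^ d * areaElement (profile M θ) φ)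
      (sphMeasure θ) := by
  obtain ⟨K, hK⟩ := h.exists_lipschitz
  refine (h.integrable_b_pow d).mul_bdd (c := √(1 + K ^ 2))
    (measurable_areaElement.comp measurable_subtype_coe).aestronglyMeasurable
    (Eventually.of_forall fun φ => ?_)
  rw [Real.norm_of_nonneg (zero_le_one.trans (one_le_areaElement _ _))]
  exact areaElement_le hK _

theorem integrable_b_pow_mul_sig (h : Good M θ) (d : ℕ) :
    Integrable (fun φ : SphPerp θ => b M θ φ ^ d * Sig M θ φ) (sphMeasure θ) := by
  refine (h.integrable_b_pow_mul_area d).congr ?_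
  filter_upwards [h.ae_sig_eq] with φ hφ
  rw [hφ]

theorem integral_b_pow_mul_sig_eq (h : Good M θ) (d : ℕ) :
    ∫ φ, b M θ φ ^ d * Sig M θ φ ∂(sphMeasure θ) =
      ∫ φ : SphPerp θ, b M θ φ ^ d * areaElement (profile M θ) φ ∂(sphMeasure θ) := by
  refine integral_congr_ae ?_
  filter_upwards [h.ae_sig_eq] with φ hφ
  rw [hφ]

theorem sphMeasure_ne_zero (h : Good M θ) : sphMeasure θ ≠ 0 := by
  have := h.nontrivial
  exact Measure.toSphere_ne_zero _

theorem integral_b_pow_pos (h : Good M θ) (d : ℕ) :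
    0 < ∫ φ : SphPerp θ, b M θ φ ^ d ∂(sphMeasure θ) := by
  rw [integral_pos_iff_support_of_nonneg (fun φ => pow_nonneg (h.b_pos φ).le d)
    (h.integrable_b_pow d)]
  have : Function.support (fun φ : SphPerp θ => b M θ φ ^ d) = univ :=
    eq_univ_of_forall fun φ => (pow_pos (h.b_pos φ) d).ne'
  rw [this]
  exact (Measure.measure_univ_pos).2 h.sphMeasure_ne_zero

/-- Integration in polar coordinates against the weight `exp(-a h)`. -/
theorem integral_exp_profile_mul (h : Good M θ) {F : Perp θ → ℝ} (hF : Measurable F)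
    (hF0 : ∀ η, 0 ≤ F η) (hFh : ∀ η, ∀ r : ℝ, 0 < r → F (r • η) = F η) {a : ℝ} (ha : 0 < a) :
    ∫ η, Real.exp (-(a * profile M θ η)) * F η =
      (1 / a) ^ (j - 1) * Real.Gamma ((j - 1 : ℕ) : ℝ) *
        ∫ φ : SphPerp θ, b M θ φ ^ (j - 1) * F φ ∂(sphMeasure θ) := by
  have hnt := h.nontrivial
  have hj := h.two_le
  have hcm : Measurable (profile M θ) := h.continuous.measurable
  have hΓ : 0 < Real.Gamma ((j - 1 : ℕ) : ℝ) :=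
    Real.Gamma_pos_of_pos (by exact_mod_cast (by omega : 0 < j - 1))
  set c := (1 / a) ^ (j - 1) * Real.Gamma ((j - 1 : ℕ) : ℝ) with hc
  have hc0 : 0 ≤ c := by positivity
  have hbm := h.measurable_b
  rw [← integral_const_mul, integral_eq_lintegral_of_nonneg_ae
    (Eventually.of_forall fun η => mul_nonneg (Real.exp_pos _).le (hF0 η))
    (by fun_prop), integral_eq_lintegral_of_nonneg_ae
    (Eventually.of_forall fun φ => mul_nonneg hc0
      (mul_nonneg (pow_nonneg (h.b_pos φ).le _) (hF0 _)))
    (by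
      have : Measurable fun φ : SphPerp θ => F φ := hF.comp measurable_subtype_coe
      fun_prop), lintegral_eq_lintegral_sphere (by fun_prop), finrank_perp]
  congr 1
  refine lintegral_congr fun φ => ?_
  have hp := h.profile_pos (sphPerp_ne_zero φ)
  have h1 : ∫⁻ r in Ioi (0 : ℝ), ENNReal.ofReal (r ^ (j - 1 - 1)) *
        ENNReal.ofReal (Real.exp (-(a * profile M θ (r • (φ : Perp θ)))) *
          F (r • (φ : Perp θ))) =
      ∫⁻ r in Ioi (0 : ℝ), ENNReal.ofReal (F φ) * ENNReal.ofReal (r ^ (j - 1 - 1) *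
        Real.exp (-(a * profile M θ φ * r))) := by
    refine setLIntegral_congr_fun measurableSet_Ioi fun r hr => ?_
    have hr' : (0 : ℝ) < r := hr
    rw [hFh _ _ hr', profile_smul hr'.le, ← ENNReal.ofReal_mul (by positivity),
      ← ENNReal.ofReal_mul (hF0 _)]
    congr 1
    rw [show a * profile M θ φ * r = a * (r * profile M θ φ) by ring]
    ring
  -- The radial integral of `r^(j-2) exp(-a h(φ) r)` is `Γ(j-1) / (a h(φ))^(j-1)`, and `1 / h(φ) =
  -- b`: this is the origin of the weight `b^(j-1)`.
  rw [h1, lintegral_const_mul' _ _ ENNReal.ofReal_ne_top,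
    lintegral_pow_mul_exp _ (by omega) (mul_pos ha hp), ← ENNReal.ofReal_mul (hF0 _)]
  congr 1
  rw [hc, h.b_sph_eq, one_div, one_div, mul_inv, mul_pow]
  ring

/-- The factor depending on `a` is the same with and without the area element, so the mean does not
depend on `a`. This leaves `a` free to be tuned to the mean itself. -/
theorem meanSig_eq (h : Good M θ) {a : ℝ} (ha : 0 < a) :
    ∫ η, Real.exp (-(a * profile M θ η)) * areaElement (profile M θ) η =
      meanSig M θ * ∫ η, Real.exp (-(a * profile M θ η)) := by
  have h1 := h.integral_exp_profile_mul (F := areaElement (profile M θ))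
    measurable_areaElement (fun η => Real.sqrt_nonneg _)
    (fun η r hr => areaElement_profile_smul η hr) ha
  have h2 := h.integral_exp_profile_mul (F := fun _ => 1) measurable_const
    (fun η => zero_le_one) (fun η r hr => rfl) ha
  simp only [mul_one] at h2
  have h3 := h.integral_b_pow_pos (j - 1)
  rw [h1, h2, meanSig, h.integral_b_pow_mul_sig_eq]
  field_simp

theorem meanSig_pos (h : Good M θ) : 0 < meanSig M θ := by
  have h3 := h.integral_b_pow_pos (j - 1)
  refine div_pos (h3.trans_le ?_) h3
  rw [h.integral_b_pow_mul_sig_eq]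
  refine integral_mono (h.integrable_b_pow _) (h.integrable_b_pow_mul_area _) fun φ => ?_
  exact le_mul_of_one_le_right (pow_nonneg (h.b_pos φ).le _) (one_le_areaElement _ _)

end Good

end SphereIntegrals

/-! ### Integration over Lipschitz epigraphs and the trace inequality -/

section Epigraph

variable {n : ℕ} {W : Type*} [NormedAddCommGroup W] [InnerProductSpace ℝ W]
  [FiniteDimensional ℝ W] [MeasurableSpace W] [BorelSpace W]

/-- The open epigraph `{t > H w}`, in the orthogonal coordinates `Ψ (w, t)`. -/
def epi (Ψ : WithLp 2 (W × ℝ) ≃ₗᵢ[ℝ] Euc n) (H : W → ℝ) : Set (Euc n) :=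
  {x | H (Ψ.symm x).fst < (Ψ.symm x).snd}

/-- The point at height `s` over the graph of `H`. -/
def epiMap (Ψ : WithLp 2 (W × ℝ) ≃ₗᵢ[ℝ] Euc n) (H : W → ℝ) (p : W × ℝ) : Euc n :=
  Ψ (WithLp.toLp 2 (p.1, H p.1 + p.2))

variable {Ψ : WithLp 2 (W × ℝ) ≃ₗᵢ[ℝ] Euc n} {H : W → ℝ} {K : ℝ≥0}

theorem finrank_add_one_eq (Ψ : WithLp 2 (W × ℝ) ≃ₗᵢ[ℝ] Euc n) :
    Module.finrank ℝ W + 1 = n := by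
  have h1 := Ψ.toLinearEquiv.finrank_eq
  rw [(WithLp.linearEquiv 2 ℝ (W × ℝ)).finrank_eq, Module.finrank_prod, Module.finrank_self,
    finrank_euclideanSpace_fin] at h1
  exact h1

theorem continuous_epiMap (hH : Continuous H) : Continuous (epiMap Ψ H) := by
  unfold epiMap
  exact Ψ.continuous.comp ((WithLp.prod_continuous_toLp 2 W ℝ).comp (by fun_prop))

theorem epiMap_injective : Function.Injective (epiMap Ψ H) := by
  rintro ⟨w, s⟩ ⟨w', s'⟩ h
  have h1 := (WithLp.toLp_injective 2) (Ψ.injective h)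
  simp only [Prod.mk.injEq] at h1
  obtain ⟨rfl, h2⟩ := h1
  simpa using h2

theorem epiMap_mem_epi_iff (p : W × ℝ) : epiMap Ψ H p ∈ epi Ψ H ↔ 0 < p.2 := by
  simp [epiMap, epi]

theorem isOpen_epi (hH : Continuous H) : IsOpen (epi Ψ H) := by
  have h1 : Continuous fun x => (Ψ.symm x).fst :=
    (WithLp.prod_continuous_ofLp 2 W ℝ).fst.comp Ψ.symm.continuous
  have h2 : Continuous fun x => (Ψ.symm x).snd :=
    (WithLp.prod_continuous_ofLp 2 W ℝ).snd.comp Ψ.symm.continuous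
  exact isOpen_lt (hH.comp h1) h2

theorem measurableEmbedding_epiMap (hH : Continuous H) : MeasurableEmbedding (epiMap Ψ H) :=
  (continuous_epiMap hH).measurableEmbedding epiMap_injective

theorem measurePreserving_epiMap_univ (hH : Continuous H) :
    MeasurePreserving (epiMap Ψ H) (volume.prod volume) volume := by
  have h1 : MeasurePreserving (fun p : W × ℝ => (p.1, H p.1 + p.2)) (volume.prod volume)
      (volume.prod volume) :=
    (MeasurePreserving.id volume).skew_product (g := fun w s => H w + s)
      (by have := hH.measurable; fun_prop)
      (Eventually.of_forall fun w => map_add_left_eq_self _ _)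
  exact (Ψ.measurePreserving.comp (WithLp.volume_preserving_toLp W ℝ)).comp h1

theorem measurePreserving_epiMap (hH : Continuous H) :
    MeasurePreserving (epiMap Ψ H) (volume.prod (volume.restrict (Ioi 0)))
      (volume.restrict (epi Ψ H)) := by
  have h1 := (measurePreserving_epiMap_univ (Ψ := Ψ) hH).restrict_preimage_emb
    (measurableEmbedding_epiMap hH) (epi Ψ H)
  have h2 : epiMap Ψ H ⁻¹' epi Ψ H = univ ×ˢ Ioi 0 := by
    ext p
    simp [epiMap_mem_epi_iff]
  rw [h2, ← Measure.prod_restrict, Measure.restrict_univ] at h1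
  exact h1

theorem isGraphMap_epiMap : IsGraphMap H (fun w => epiMap Ψ H (w, 0)) := by
  intro x y
  simp only [epiMap, add_zero]
  rw [Ψ.dist_map, WithLp.prod_dist_eq_of_L2, dist_eq_norm, Real.dist_eq, sq_abs]
  rfl

theorem frontier_epi (hH : Continuous H) :
    frontier (epi Ψ H) = range fun w => epiMap Ψ H (w, 0) := by
  have h1 : Continuous fun x => (Ψ.symm x).fst :=
    (WithLp.prod_continuous_ofLp 2 W ℝ).fst.comp Ψ.symm.continuous
  have h2 : Continuous fun x => (Ψ.symm x).snd :=
    (WithLp.prod_continuous_ofLp 2 W ℝ).snd.comp Ψ.symm.continuous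
  have h3 : epi Ψ H = {x | 0 < (Ψ.symm x).snd - H (Ψ.symm x).fst} := by
    ext x; simp [epi]
  have h4 : Continuous fun x => (Ψ.symm x).snd - H (Ψ.symm x).fst := h2.sub (hH.comp h1)
  rw [h3, frontier_setOf_pos_eq h4 (v := Ψ (WithLp.toLp 2 (0, 1)))]
  · ext x
    constructor
    · intro hx
      refine ⟨(Ψ.symm x).fst, ?_⟩
      have hx' : (Ψ.symm x).snd - H (Ψ.symm x).fst = 0 := hx
      rw [sub_eq_zero] at hx'
      simp only [epiMap, add_zero, ← hx']
      exact Ψ.apply_symm_apply x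
    · rintro ⟨w, rfl⟩
      simp [epiMap]
  · intro z s
    simp
    ring

theorem bdryMeasure_epi (hH : LipschitzWith K H) : bdryMeasure (epi Ψ H) =
    (volume.withDensity fun w => ENNReal.ofReal (areaElement H w)).map
      fun w => epiMap Ψ H (w, 0) := by
  have h1 : n - 1 = Module.finrank ℝ W := by
    rw [← finrank_add_one_eq Ψ, Nat.add_sub_cancel]
  rw [bdryMeasure, frontier_epi hH.continuous, h1]
  exact isGraphMap_epiMap.restrict_range_eq hH

theorem integral_bdryMeasure_epi (hH : LipschitzWith K H) (f : Euc n → ℝ) :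
    ∫ x, f x ∂(bdryMeasure (epi Ψ H)) = ∫ w, areaElement H w * f (epiMap Ψ H (w, 0)) := by
  have hemb := (isGraphMap_epiMap (Ψ := Ψ) (H := H)).measurableEmbedding hH
  rw [bdryMeasure_epi hH, hemb.integral_map]
  have := integral_withDensity_eq_integral_toReal_smul (μ := (volume : Measure W))
    (f := fun w => ENNReal.ofReal (areaElement H w)) (by
      have := measurable_areaElement (H := H); fun_prop)
    (Eventually.of_forall fun w => ENNReal.ofReal_lt_top) (fun w => f (epiMap Ψ H (w, 0)))
  rw [this]
  refine integral_congr_ae (Eventually.of_forall fun w => ?_)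
  simp only [smul_eq_mul]
  rw [ENNReal.toReal_ofReal (areaElement_nonneg _)]

theorem integrable_bdryMeasure_epi (hH : LipschitzWith K H) {f : Euc n → ℝ}
    (hf : Integrable fun w => f (epiMap Ψ H (w, 0))) :
    Integrable f (bdryMeasure (epi Ψ H)) := by
  have hemb := (isGraphMap_epiMap (Ψ := Ψ) (H := H)).measurableEmbedding hH
  rw [bdryMeasure_epi hH, hemb.integrable_map_iff]
  rw [integrable_withDensity_iff_integrable_smul' (by
      have := measurable_areaElement (H := H); fun_prop)
    (Eventually.of_forall fun w => ENNReal.ofReal_lt_top)]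
  have h1 : (fun w => (ENNReal.ofReal (areaElement H w)).toReal •
      (f ∘ fun w => epiMap Ψ H (w, 0)) w) =
      fun w => areaElement H w * f (epiMap Ψ H (w, 0)) := by
    ext w
    rw [ENNReal.toReal_ofReal (areaElement_nonneg _)]
    rfl
  rw [h1]
  refine hf.bdd_mul (c := √(1 + K ^ 2)) measurable_areaElement.aestronglyMeasurable
    (Eventually.of_forall (norm_areaElement_le hH))

theorem isClosedEmbedding_graph (hH : LipschitzWith K H) :
    IsClosedEmbedding fun w => epiMap Ψ H (w, 0) := by
  have h1 : AntilipschitzWith 1 fun w => epiMap Ψ H (w, 0) := by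
    refine AntilipschitzWith.of_le_mul_dist fun x y => ?_
    rw [isGraphMap_epiMap x y, NNReal.coe_one, one_mul, dist_eq_norm]
    exact Real.le_sqrt_of_sq_le (le_add_of_nonneg_right (sq_nonneg _))
  exact h1.isClosedEmbedding ((isGraphMap_epiMap.lipschitz hH).uniformContinuous)

theorem integrable_graph_of_hasCompactSupport (hH : LipschitzWith K H) {f : Euc n → ℝ}
    (hf : Continuous f) (hc : HasCompactSupport f) :
    Integrable fun w => f (epiMap Ψ H (w, 0)) :=
  (hf.comp (isClosedEmbedding_graph hH).continuous).integrable_of_hasCompactSupport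
    (hc.comp_isClosedEmbedding (isClosedEmbedding_graph hH))

/-- Along the fibre `S u(0)² = -2S ∫ u ∂ₑu`, and `-2S u ∂ₑu ≤ (∂ₑu)² + S² u²` with `|∂ₑu| ≤ ‖∇u‖`
since `e` is a unit vector. -/
theorem mul_sq_le_integral_fiber (hH : Continuous H) {u : Euc n → ℝ} (hu : ContDiff ℝ 1 u)
    (hc : HasCompactSupport u) (S : ℝ) (w : W)
    (hint : IntegrableOn (fun s => ‖gradient u (epiMap Ψ H (w, s))‖ ^ 2 +
      S ^ 2 * u (epiMap Ψ H (w, s)) ^ 2) (Ioi 0)) :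
    S * u (epiMap Ψ H (w, 0)) ^ 2 ≤ ∫ s in Ioi (0 : ℝ), (‖gradient u (epiMap Ψ H (w, s))‖ ^ 2 +
      S ^ 2 * u (epiMap Ψ H (w, s)) ^ 2) := by
  set e : Euc n := Ψ (WithLp.toLp 2 (0, 1)) with he
  have hen : ‖e‖ = 1 := by
    rw [he, Ψ.norm_map, WithLp.prod_norm_eq_of_L2]; simp
  have hmap : ∀ s : ℝ, epiMap Ψ H (w, s) = epiMap Ψ H (w, 0) + s • e := by
    intro s
    rw [he, epiMap, epiMap, ← map_smul, ← map_add]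
    congr 1
    rw [← WithLp.toLp_smul, ← WithLp.toLp_add]
    simp
  have hder : ∀ s : ℝ, HasDerivAt (fun s => u (epiMap Ψ H (w, s)) ^ 2)
      (2 * u (epiMap Ψ H (w, s)) * ⟪gradient u (epiMap Ψ H (w, s)), e⟫) s := by
    intro s
    have h1 : HasDerivAt (fun s => epiMap Ψ H (w, s)) e s := by
      have h2 := ((hasDerivAt_id s).smul_const e).const_add (epiMap Ψ H (w, 0))
      rw [one_smul] at h2
      exact h2.congr_of_eventuallyEq (Eventually.of_forall hmap)
    have h2 := ((hu.differentiable one_ne_zero) (epiMap Ψ H (w, s))).hasFDerivAt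
    have h3 := (h2.comp_hasDerivAt s h1).pow 2
    rw [inner_gradient_left]
    refine (h3.congr_deriv ?_)
    simp
  have hsupp : HasCompactSupport fun s => u (epiMap Ψ H (w, s)) := by
    have hiso : Isometry fun s : ℝ => epiMap Ψ H (w, s) := by
      refine Isometry.of_dist_eq fun s t => ?_
      rw [hmap s, hmap t, dist_add_left, dist_eq_norm, ← sub_smul, norm_smul, hen, mul_one,
        Real.dist_eq, Real.norm_eq_abs]
    exact hc.comp_isClosedEmbedding hiso.isClosedEmbedding
  have hgc : Continuous (gradient u) :=
    (InnerProductSpace.toDual ℝ (Euc n)).symm.continuous.comp (hu.continuous_fderiv one_ne_zero)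
  have hmc : Continuous fun s => epiMap Ψ H (w, s) :=
    (continuous_epiMap hH).comp (by fun_prop)
  have hdint : Integrable fun s =>
      2 * u (epiMap Ψ H (w, s)) * ⟪gradient u (epiMap Ψ H (w, s)), e⟫ := by
    refine Continuous.integrable_of_hasCompactSupport ?_ (hsupp.mul_left.mul_right)
    have h1 := hu.continuous.comp hmc
    have h2 := hgc.comp hmc
    simp only [Function.comp_def] at h1 h2
    fun_prop
  have hlim : Tendsto (fun s => u (epiMap Ψ H (w, s)) ^ 2) atTop (𝓝 0) := by
    have h1 : (fun s => u (epiMap Ψ H (w, s))) =ᶠ[atTop] 0 :=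
      (hasCompactSupport_iff_eventuallyEq.1 hsupp).filter_mono
        (by rw [coclosedCompact_eq_cocompact]; exact atTop_le_cocompact)
    refine tendsto_const_nhds.congr' (h1.mono fun s hs => ?_)
    simp only [Pi.zero_apply] at hs
    simp [hs]
  have hftc := integral_Ioi_of_hasDerivAt_of_tendsto' (a := 0) (fun s _ => hder s)
    hdint.integrableOn hlim
  have hle : -(S * ∫ s in Ioi (0 : ℝ),
      2 * u (epiMap Ψ H (w, s)) * ⟪gradient u (epiMap Ψ H (w, s)), e⟫) ≤
      ∫ s in Ioi (0 : ℝ), (‖gradient u (epiMap Ψ H (w, s))‖ ^ 2 +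
      S ^ 2 * u (epiMap Ψ H (w, s)) ^ 2) := by
    rw [← integral_const_mul, ← integral_neg]
    refine integral_mono (hdint.integrableOn.const_mul S).neg hint fun s => ?_
    have h1 : |⟪gradient u (epiMap Ψ H (w, s)), e⟫| ≤ ‖gradient u (epiMap Ψ H (w, s))‖ := by
      simpa [hen] using abs_real_inner_le_norm (gradient u (epiMap Ψ H (w, s))) e
    have h2 : ⟪gradient u (epiMap Ψ H (w, s)), e⟫ ^ 2 ≤
        ‖gradient u (epiMap Ψ H (w, s))‖ ^ 2 := by
      rw [← sq_abs]; gcongr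
    dsimp only
    nlinarith [sq_nonneg (⟪gradient u (epiMap Ψ H (w, s)), e⟫ + S * u (epiMap Ψ H (w, s)))]
  rw [hftc] at hle
  linarith

/-- The trace inequality on a Lipschitz epigraph. -/
theorem integral_bdry_sq_le (hH : LipschitzWith K H) {S : ℝ}
    (hS : ∀ᵐ w, areaElement H w ≤ S) {u : Euc n → ℝ} (hu : ContDiff ℝ 1 u)
    (hc : HasCompactSupport u) :
    ∫ x, u x ^ 2 ∂(bdryMeasure (epi Ψ H)) ≤
      (∫ x in epi Ψ H, ‖gradient u x‖ ^ 2) + S ^ 2 * ∫ x in epi Ψ H, u x ^ 2 := by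
  have hgc : Continuous (gradient u) :=
    (InnerProductSpace.toDual ℝ (Euc n)).symm.continuous.comp (hu.continuous_fderiv one_ne_zero)
  have hgs : HasCompactSupport (gradient u) := by
    refine (hc.fderiv ℝ).comp_left (g := (InnerProductSpace.toDual ℝ (Euc n)).symm) ?_
    simp
  have hi1 : Integrable fun x => ‖gradient u x‖ ^ 2 := by
    refine Continuous.integrable_of_hasCompactSupport (by fun_prop) ?_
    exact hgs.comp_left (g := fun v => ‖v‖ ^ 2) (by simp)
  have hcu := hu.continuous
  have hus : HasCompactSupport fun x => u x ^ 2 := hc.comp_left (g := fun v : ℝ => v ^ 2) (by simp)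
  have hi2 : Integrable fun x => u x ^ 2 :=
    Continuous.integrable_of_hasCompactSupport (by fun_prop) hus
  have hi : IntegrableOn (fun x => ‖gradient u x‖ ^ 2 + S ^ 2 * u x ^ 2) (epi Ψ H) :=
    (hi1.add (hi2.const_mul _)).integrableOn
  have hemb := measurableEmbedding_epiMap (Ψ := Ψ) hH.continuous
  have hmp := measurePreserving_epiMap (Ψ := Ψ) hH.continuous
  have hi' := (hmp.integrable_comp_emb hemb).2 hi
  have hig : Integrable fun w => u (epiMap Ψ H (w, 0)) ^ 2 :=
    integrable_graph_of_hasCompactSupport hH (by fun_prop) hus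
  rw [← integral_const_mul, ← integral_add hi1.integrableOn (hi2.const_mul _).integrableOn,
    ← hmp.integral_comp hemb]
  refine le_of_le_of_eq ?_ (integral_prod _ hi').symm
  rw [integral_bdryMeasure_epi hH]
  -- One factor `S` bounds the area element; the fibre inequality absorbs the resulting `S u²`.
  refine (integral_mono_ae (g := fun w => S * u (epiMap Ψ H (w, 0)) ^ 2) ?_
    (hig.const_mul S) ?_).trans (integral_mono_ae (hig.const_mul S) hi'.integral_prod_left ?_)
  · refine hig.bdd_mul (c := √(1 + K ^ 2)) measurable_areaElement.aestronglyMeasurable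
      (Eventually.of_forall (norm_areaElement_le hH))
  · filter_upwards [hS] with w hw
    gcongr
  · filter_upwards [hi'.prod_right_ae] with w hw
    exact mul_sq_le_integral_fiber hH.continuous hu hc S w hw

end Epigraph

/-! ### Passage to `H¹` and estimates of the Rayleigh infimum -/

section Limits

variable {α : Type*} [MeasurableSpace α] {μ : Measure α}
  {E : Type*} [NormedAddCommGroup E]

theorem integral_norm_sq_eq_eLpNorm {f : α → E} (hf : AEStronglyMeasurable f μ) :
    ∫ x, ‖f x‖ ^ 2 ∂μ = (eLpNorm f 2 μ ^ 2).toReal := by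
  have h1 := eLpNorm_nnreal_pow_eq_lintegral (μ := μ) (f := f) (p := 2) two_ne_zero
  rw [integral_eq_lintegral_of_nonneg_ae (Eventually.of_forall fun x => sq_nonneg _)
    (hf.norm.pow 2)]
  congr 1
  have h2 : (eLpNorm f 2 μ) ^ 2 = eLpNorm f ((2 : ℝ≥0) : ℝ≥0∞) μ ^ (((2 : ℝ≥0) : ℝ)) := by
    norm_num
  rw [h2, h1]
  refine lintegral_congr fun x => ?_
  rw [ENNReal.ofReal_pow (norm_nonneg _), ofReal_norm]
  norm_num

theorem tendsto_integral_norm_sq {f : ℕ → α → E} {g : α → E}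
    (hf : ∀ k, AEStronglyMeasurable (f k) μ) (hg : MemLp g 2 μ)
    (h : Tendsto (fun k => eLpNorm (fun x => f k x - g x) 2 μ) atTop (𝓝 0)) :
    Tendsto (fun k => ∫ x, ‖f k x‖ ^ 2 ∂μ) atTop (𝓝 (∫ x, ‖g x‖ ^ 2 ∂μ)) := by
  have h1 : Tendsto (fun k => eLpNorm (f k) 2 μ) atTop (𝓝 (eLpNorm g 2 μ)) := by
    have hlow : Tendsto (fun k => eLpNorm g 2 μ - eLpNorm (fun x => f k x - g x) 2 μ) atTop
        (𝓝 (eLpNorm g 2 μ)) := by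
      simpa using ENNReal.Tendsto.sub (tendsto_const_nhds (x := eLpNorm g 2 μ)) h
        (Or.inl hg.eLpNorm_ne_top)
    have hup : Tendsto (fun k => eLpNorm g 2 μ + eLpNorm (fun x => f k x - g x) 2 μ) atTop
        (𝓝 (eLpNorm g 2 μ)) := by
      simpa using (tendsto_const_nhds (x := eLpNorm g 2 μ)).add h
    refine tendsto_of_tendsto_of_tendsto_of_le_of_le hlow hup (fun k => ?_) fun k => ?_
    · rw [tsub_le_iff_right]
      have h2 := eLpNorm_sub_le (hf k) ((hf k).sub hg.1) (p := 2) one_le_two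
      have h3 : f k - (f k - g) = g := sub_sub_cancel _ _
      rw [h3] at h2
      exact h2
    · have h2 := eLpNorm_add_le hg.1 ((hf k).sub hg.1) (p := 2) one_le_two
      rw [add_sub_cancel] at h2
      exact h2
  simp_rw [integral_norm_sq_eq_eLpNorm (hf _)]
  rw [integral_norm_sq_eq_eLpNorm hg.1]
  exact (ENNReal.tendsto_toReal (ENNReal.pow_ne_top hg.eLpNorm_ne_top)).comp
    (ENNReal.Tendsto.pow h1)

end Limits

section Bounds

variable {n : ℕ} {W : Type*} [NormedAddCommGroup W] [InnerProductSpace ℝ W]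
  [FiniteDimensional ℝ W] [MeasurableSpace W] [BorelSpace W]
  {Ψ : WithLp 2 (W × ℝ) ≃ₗᵢ[ℝ] Euc n} {H : W → ℝ} {K : ℝ≥0}

theorem continuous_gradient {u : Euc n → ℝ} (hu : ContDiff ℝ 1 u) : Continuous (gradient u) :=
  (InnerProductSpace.toDual ℝ (Euc n)).symm.continuous.comp (hu.continuous_fderiv one_ne_zero)

/-- All three terms of the smooth inequality converge along the sequence that defines the trace. -/
theorem integral_trace_sq_le (hH : LipschitzWith K H) {S : ℝ}
    (hS : ∀ᵐ w, areaElement H w ≤ S) {v : Euc n → ℝ} {w : Euc n → Euc n} {g : Euc n → ℝ}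
    (hv : IsH1 (epi Ψ H) v w) (hg : IsTrace (epi Ψ H) v w g) :
    ∫ x, g x ^ 2 ∂(bdryMeasure (epi Ψ H)) ≤
      (∫ x in epi Ψ H, ‖w x‖ ^ 2) + S ^ 2 * ∫ x in epi Ψ H, v x ^ 2 := by
  obtain ⟨u, hu, h1, h2, h3⟩ := hg.approx
  have hu1 : ∀ k, ContDiff ℝ 1 (u k) := fun k => (hu k).1.of_le (by exact_mod_cast le_top)
  have t1 := tendsto_integral_norm_sq
    (fun k => (hu k).1.continuous.aestronglyMeasurable) hv.memLp h1
  have t2 := tendsto_integral_norm_sq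
    (fun k => (continuous_gradient (hu1 k)).aestronglyMeasurable) hv.memLp_grad h2
  have t3 := tendsto_integral_norm_sq
    (fun k => (hu k).1.continuous.aestronglyMeasurable) hg.memLp h3
  simp only [Real.norm_eq_abs, sq_abs] at t1 t3
  exact le_of_tendsto_of_tendsto' t3 (t2.add (t1.const_mul (S ^ 2)))
    fun k => integral_bdry_sq_le hH hS (hu1 k) (hu k).2

theorem neg_sq_le_bottom (hH : LipschitzWith K H) {S : ℝ}
    (hS : ∀ᵐ w, areaElement H w ≤ S) :
    ((-(S ^ 2) : ℝ) : EReal) ≤ bottom (epi Ψ H) 1 := by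
  refine le_sInf ?_
  rintro t ⟨v, w, g, hv, hg, hne, rfl⟩
  rw [EReal.coe_le_coe_iff]
  have h1 := integral_trace_sq_le hH hS hv hg
  have hpos : 0 < ∫ x in epi Ψ H, v x ^ 2 := by
    refine lt_of_le_of_ne (integral_nonneg fun x => sq_nonneg _) fun h0 => hne ?_
    have h2 := (integral_eq_zero_iff_of_nonneg (fun x => sq_nonneg (v x))
      hv.memLp.integrable_sq).1 h0.symm
    filter_upwards [h2] with x hx
    simpa using hx
  rw [rayleigh, le_div_iff₀ hpos]
  linarith

theorem isH1_of_smooth {U : Set (Euc n)} {u : Euc n → ℝ} (hu : ContDiff ℝ 1 u)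
    (hc : HasCompactSupport u) : IsH1 U u (gradient u) := by
  have hgc := continuous_gradient hu
  have hgs : HasCompactSupport (gradient u) := by
    refine (hc.fderiv ℝ).comp_left (g := (InnerProductSpace.toDual ℝ (Euc n)).symm) ?_
    simp
  refine ⟨(hu.continuous.memLp_of_hasCompactSupport hc).restrict _,
    (hgc.memLp_of_hasCompactSupport hgs).restrict _, ?_⟩
  intro χ hχ hχc hχU
  have hχ1 : ContDiff ℝ 1 χ := hχ.of_le (by exact_mod_cast le_top)
  have hχg : tsupport (gradient χ) ⊆ tsupport χ := by
    refine (closure_mono fun x hx => ?_).trans (tsupport_fderiv_subset ℝ (f := χ))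
    intro h0
    exact hx (by rw [gradient, h0, map_zero])
  have hχgc := continuous_gradient hχ1
  rw [setIntegral_eq_integral_of_forall_compl_eq_zero,
    setIntegral_eq_integral_of_forall_compl_eq_zero]
  -- The vector identity is tested against each `e`, which reduces it to integration by parts in the
  -- direction `e`.
  · refine ext_inner_left ℝ fun e => ?_
    have hi1 : Integrable fun x => u x • gradient χ x :=
      (hu.continuous.smul hχgc).integrable_of_hasCompactSupport hc.smul_right
    have hi2 : Integrable fun x => χ x • gradient u x :=
      (hχ.continuous.smul hgc).integrable_of_hasCompactSupport hχc.smul_right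
    have hi3 : Integrable fun x => u x * χ x :=
      (hu.continuous.mul hχ.continuous).integrable_of_hasCompactSupport hc.mul_right
    rw [inner_neg_right, ← integral_inner hi1, ← integral_inner hi2]
    have h1 := hi1.const_inner (𝕜 := ℝ) e
    have h2 := hi2.const_inner (𝕜 := ℝ) e
    simp only [inner_smul_right, inner_gradient_right, conj_trivial] at h1 h2 ⊢
    have h2' : Integrable fun x => fderiv ℝ u x e * χ x := by
      simpa only [mul_comm] using h2
    rw [integral_mul_fderiv_eq_neg_fderiv_mul_of_integrable h2' h1 hi3
      (fun x _ => hu.differentiable one_ne_zero x) (fun x _ => hχ1.differentiable one_ne_zero x)]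
    simp only [mul_comm]
  · intro x hx
    rw [image_eq_zero_of_notMem_tsupport (fun h => hx (hχU h)), zero_smul]
  · intro x hx
    rw [image_eq_zero_of_notMem_tsupport (fun h => hx (hχU (hχg h))), smul_zero]

theorem bottom_le_of_smooth {U : Set (Euc n)} {u : Euc n → ℝ} (hu : ContDiff ℝ ∞ u)
    (hc : HasCompactSupport u) (hb : MemLp u 2 (bdryMeasure U)) (hpos : 0 < ∫ x in U, u x ^ 2) :
    bottom U 1 ≤ ((((∫ x in U, ‖gradient u x‖ ^ 2) - ∫ x, u x ^ 2 ∂(bdryMeasure U)) /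
      ∫ x in U, u x ^ 2 : ℝ) : EReal) := by
  refine sInf_le ⟨u, gradient u, u, isH1_of_smooth (hu.of_le (by exact_mod_cast le_top)) hc,
    ⟨hb, fun _ => u, fun _ => ⟨hu, hc⟩, by simp, by simp, by simp⟩, fun h0 => ?_, ?_⟩
  · have : ∫ x in U, u x ^ 2 = 0 := by
      refine integral_eq_zero_of_ae ?_
      filter_upwards [h0] with x hx
      simp only [Pi.zero_apply] at hx ⊢
      simp [hx]
    exact hpos.ne' this
  · rw [rayleigh, one_mul]

end Bounds

/-! ### Exponential test functions and their truncation -/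

section TestFunctions

theorem integrable_exp_neg_mul_norm {E : Type*} [NormedAddCommGroup E] [NormedSpace ℝ E]
    [FiniteDimensional ℝ E] [MeasurableSpace E] [BorelSpace E] (μ : Measure E)
    [μ.IsAddHaarMeasure] {a : ℝ} (ha : 0 < a) : Integrable (fun x => Real.exp (-(a * ‖x‖))) μ := by
  -- `(1 + ‖x‖)^(-N)` is integrable as soon as `N` exceeds the dimension; it dominates the
  -- exponential through the `N`-th term of the exponential series.
  set N := Module.finrank ℝ E + 1 with hN
  have h1 : Integrable (fun x : E => (1 + ‖x‖) ^ (-(N : ℝ))) μ :=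
    integrable_one_add_norm (by rw [hN]; push_cast; linarith)
  refine (h1.const_mul (Real.exp a * N.factorial / a ^ N)).mono'
    (by fun_prop) (Eventually.of_forall fun x => ?_)
  have hx : 0 < 1 + ‖x‖ := by positivity
  have h2 := Real.pow_div_factorial_le_exp (a * (1 + ‖x‖)) (by positivity) N
  rw [Real.norm_of_nonneg (Real.exp_pos _).le, Real.rpow_neg hx.le, Real.rpow_natCast]
  have h3 : Real.exp (-(a * ‖x‖)) = Real.exp a / Real.exp (a * (1 + ‖x‖)) := by
    rw [← Real.exp_sub]; congr 1; ring
  rw [h3, div_le_iff₀ (Real.exp_pos _)]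
  calc Real.exp a = Real.exp a * N.factorial / a ^ N * ((1 + ‖x‖) ^ N)⁻¹ *
        ((a * (1 + ‖x‖)) ^ N / N.factorial) := by
        rw [mul_pow]; field_simp
    _ ≤ _ := by gcongr

section Cutoff

variable {n : ℕ} {W : Type*} [NormedAddCommGroup W] [InnerProductSpace ℝ W]
  [FiniteDimensional ℝ W] [MeasurableSpace W] [BorelSpace W]
  {Ψ : WithLp 2 (W × ℝ) ≃ₗᵢ[ℝ] Euc n} {H : W → ℝ} {K : ℝ≥0}

theorem norm_gradient {u : Euc n → ℝ} (x : Euc n) : ‖gradient u x‖ = ‖fderiv ℝ u x‖ := by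
  rw [gradient, LinearIsometryEquiv.norm_map]

theorem exists_cutoff (n : ℕ) : ∃ (χ : Euc n → ℝ) (C : ℝ), ContDiff ℝ ∞ χ ∧ HasCompactSupport χ ∧
    χ 0 = 1 ∧ (∀ x, 0 ≤ χ x) ∧ (∀ x, χ x ≤ 1) ∧ ∀ x, ‖fderiv ℝ χ x‖ ≤ C := by
  let f : ContDiffBump (0 : Euc n) := ⟨1, 2, one_pos, one_lt_two⟩
  have hd : Continuous (fderiv ℝ f) := (f.contDiff (n := 1)).continuous_fderiv one_ne_zero
  obtain ⟨C, hC⟩ := (f.hasCompactSupport.fderiv ℝ).exists_bound_of_continuous hd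
  exact ⟨f, C, f.contDiff, f.hasCompactSupport, f.one_of_mem_closedBall (by simp [f.rIn_pos.le]),
    fun x => f.nonneg, fun x => f.le_one, hC⟩

theorem norm_fderiv_cutoff_mul_exp_le {χ ψ : Euc n → ℝ} {C L δ : ℝ} (hχ : ContDiff ℝ ∞ χ)
    (hχ0 : ∀ x, 0 ≤ χ x) (hχ1 : ∀ x, χ x ≤ 1) (hχC : ∀ x, ‖fderiv ℝ χ x‖ ≤ C)
    (hψ : ContDiff ℝ ∞ ψ) (hψL : ∀ x, ‖fderiv ℝ ψ x‖ ≤ L) (hδ : 0 ≤ δ) (x : Euc n) :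
    ‖fderiv ℝ (fun x => χ (δ • x) * Real.exp (ψ x)) x‖ ≤ (L + δ * C) * Real.exp (ψ x) := by
  have h1 : HasFDerivAt (fun x => χ (δ • x)) (δ • fderiv ℝ χ (δ • x)) x := by
    have h2 : HasFDerivAt (fun x : Euc n => δ • x) (δ • ContinuousLinearMap.id ℝ (Euc n)) x :=
      (hasFDerivAt_id x).const_smul δ
    have h3 := ((hχ.differentiable (by simp)) (δ • x)).hasFDerivAt
    refine (HasFDerivAt.comp x h3 h2).congr_fderiv ?_
    ext w; simp
  have h2 := ((hψ.differentiable (by simp)) x).hasFDerivAt.exp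
  have h5 : HasFDerivAt (fun x => χ (δ • x) * Real.exp (ψ x)) _ x := h1.mul h2
  rw [h5.fderiv]
  have he := (Real.exp_pos (ψ x)).le
  have hL : 0 ≤ L := (norm_nonneg _).trans (hψL x)
  refine (norm_add_le _ _).trans ?_
  rw [norm_smul, norm_smul, norm_smul, norm_smul, Real.norm_of_nonneg (hχ0 _),
    Real.norm_of_nonneg he, Real.norm_of_nonneg hδ]
  have h3 : χ (δ • x) * (Real.exp (ψ x) * ‖fderiv ℝ ψ x‖) ≤ 1 * (Real.exp (ψ x) * L) := by
    gcongr
    · exact hχ1 _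
    · exact hψL x
  have h4 : Real.exp (ψ x) * (δ * ‖fderiv ℝ χ (δ • x)‖) ≤ Real.exp (ψ x) * (δ * C) := by
    gcongr
    exact hχC _
  linarith

theorem tendsto_integral_cutoff_sq {μ : Measure (Euc n)} {χ ψ : Euc n → ℝ} (hχ : Continuous χ)
    (hχ00 : χ 0 = 1) (hχ0 : ∀ x, 0 ≤ χ x) (hχ1 : ∀ x, χ x ≤ 1) (hψ : Continuous ψ)
    (hint : Integrable (fun x => Real.exp (2 * ψ x)) μ) {δ : ℕ → ℝ}
    (hδ : Tendsto δ atTop (𝓝 0)) :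
    Tendsto (fun k => ∫ x, (χ (δ k • x) * Real.exp (ψ x)) ^ 2 ∂μ) atTop
      (𝓝 (∫ x, Real.exp (2 * ψ x) ∂μ)) := by
  have hexp : ∀ x, Real.exp (2 * ψ x) = Real.exp (ψ x) ^ 2 := fun x => by
    rw [← Real.exp_nat_mul]; norm_num
  refine tendsto_integral_of_dominated_convergence _ (fun k => ?_) hint (fun k => ?_) ?_
  · exact Continuous.aestronglyMeasurable (by fun_prop)
  · refine Eventually.of_forall fun x => ?_
    rw [Real.norm_of_nonneg (sq_nonneg _), mul_pow, hexp]
    exact mul_le_of_le_one_left (sq_nonneg _) (pow_le_one₀ (hχ0 _) (hχ1 _))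
  · refine Eventually.of_forall fun x => ?_
    have h1 : Tendsto (fun k => χ (δ k • x)) atTop (𝓝 1) := by
      have h2 : Tendsto (fun k => δ k • x) atTop (𝓝 ((0 : ℝ) • x)) := hδ.smul_const x
      rw [zero_smul] at h2
      have h3 := (hχ.tendsto 0).comp h2
      rwa [hχ00] at h3
    have h4 := (h1.mul_const (Real.exp (ψ x))).pow 2
    rwa [one_mul, ← hexp] at h4

/-- `exp ψ` lacks compact support, so it is multiplied by `χ(δ x)` with `δ → 0`. The cutoff raises
the gradient bound only from `L` to `L + δ C`, and the other integrals converge by domination. -/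
theorem bottom_le_of_exp (hH : LipschitzWith K H) {ψ : Euc n → ℝ} (hψ : ContDiff ℝ ∞ ψ) {L : ℝ}
    (hψL : ∀ x, ‖fderiv ℝ ψ x‖ ≤ L)
    (hint : IntegrableOn (fun x => Real.exp (2 * ψ x)) (epi Ψ H))
    (hbd : Integrable (fun x => Real.exp (2 * ψ x)) (bdryMeasure (epi Ψ H))) :
    bottom (epi Ψ H) 1 ≤ ((L ^ 2 - (∫ x, Real.exp (2 * ψ x) ∂(bdryMeasure (epi Ψ H))) /
      ∫ x in epi Ψ H, Real.exp (2 * ψ x) : ℝ) : EReal) := by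
  obtain ⟨χ, C, hχ, hχc, hχ00, hχ0, hχ1, hχC⟩ := exists_cutoff n
  set I := ∫ x in epi Ψ H, Real.exp (2 * ψ x) with hI
  set B := ∫ x, Real.exp (2 * ψ x) ∂(bdryMeasure (epi Ψ H)) with hB
  have hexp : ∀ x, Real.exp (2 * ψ x) = Real.exp (ψ x) ^ 2 := fun x => by
    rw [← Real.exp_nat_mul]; norm_num
  have hIpos : 0 < I := by
    have hne : (epi Ψ H).Nonempty := ⟨epiMap Ψ H (0, 1), by simp [epiMap_mem_epi_iff]⟩
    have : NeZero ((volume : Measure (Euc n)).restrict (epi Ψ H)) := by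
      refine ⟨fun h0 => ?_⟩
      rw [Measure.restrict_eq_zero] at h0
      exact (isOpen_epi hH.continuous).measure_ne_zero volume hne h0
    exact integral_exp_pos hint
  set δ : ℕ → ℝ := fun k => 1 / ((k : ℝ) + 1) with hδ
  have hδ0 : ∀ k, 0 < δ k := fun k => by positivity
  have hδt : Tendsto δ atTop (𝓝 0) := tendsto_one_div_add_atTop_nhds_zero_nat
  set u : ℕ → Euc n → ℝ := fun k x => χ (δ k • x) * Real.exp (ψ x) with hu
  have hus : ∀ k, ContDiff ℝ ∞ (u k) := fun k =>
    (hχ.comp (contDiff_const_smul (δ k))).mul (Real.contDiff_exp.comp hψ)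
  have huc : ∀ k, HasCompactSupport (u k) := fun k =>
    (hχc.comp_smul (hδ0 k).ne').mul_right
  have t1 := tendsto_integral_cutoff_sq hχ.continuous hχ00 hχ0 hχ1 hψ.continuous hint hδt
  have t2 := tendsto_integral_cutoff_sq hχ.continuous hχ00 hχ0 hχ1 hψ.continuous hbd hδt
  have hub : ∀ k, MemLp (u k) 2 (bdryMeasure (epi Ψ H)) := by
    intro k
    rw [memLp_two_iff_integrable_sq (hus k).continuous.aestronglyMeasurable]
    refine hbd.mono' ((hus k).continuous.pow 2).aestronglyMeasurable
      (Eventually.of_forall fun x => ?_)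
    rw [Real.norm_of_nonneg (sq_nonneg _), hexp, hu, mul_pow]
    exact mul_le_of_le_one_left (sq_nonneg _) (pow_le_one₀ (hχ0 _) (hχ1 _))
  have hgrad : ∀ k, ∫ x in epi Ψ H, ‖gradient (u k) x‖ ^ 2 ≤ (L + δ k * C) ^ 2 * I := by
    intro k
    rw [hI, ← integral_const_mul]
    refine integral_mono_of_nonneg (Eventually.of_forall fun x => sq_nonneg _)
      (hint.const_mul _) (Eventually.of_forall fun x => ?_)
    dsimp only
    rw [norm_gradient, hexp, ← mul_pow]
    exact pow_le_pow_left₀ (norm_nonneg _)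
      (norm_fderiv_cutoff_mul_exp_le hχ hχ0 hχ1 hχC hψ hψL (hδ0 k).le x) 2
  have hlim : Tendsto (fun k => ((L + δ k * C) ^ 2 * I -
      ∫ x, u k x ^ 2 ∂(bdryMeasure (epi Ψ H))) / ∫ x in epi Ψ H, u k x ^ 2) atTop
      (𝓝 (L ^ 2 - B / I)) := by
    have h1 : Tendsto (fun k => (L + δ k * C) ^ 2 * I) atTop (𝓝 ((L + 0 * C) ^ 2 * I)) :=
      (((hδt.mul_const C).const_add L).pow 2).mul_const I
    have h2 := (h1.sub t2).div t1 hIpos.ne'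
    have h3 : ((L + 0 * C) ^ 2 * I - B) / I = L ^ 2 - B / I := by
      field_simp; ring
    rw [← hB, ← hI, h3] at h2
    exact h2
  have hlim' := (continuous_coe_real_ereal.tendsto (L ^ 2 - B / I)).comp hlim
  refine ge_of_tendsto hlim' ?_
  filter_upwards [t1.eventually_const_lt hIpos] with k hk
  refine (bottom_le_of_smooth (hus k) (huc k) (hub k) hk).trans ?_
  simp only [Function.comp_apply]
  rw [EReal.coe_le_coe_iff]
  gcongr
  exact hgrad k

end Cutoff

end TestFunctions

/-! ### Epigraphs that are cylindrical along an edge -/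

section ProductEpigraph

variable {n : ℕ} {V E : Type*} [NormedAddCommGroup V] [InnerProductSpace ℝ V]
  [FiniteDimensional ℝ V] [MeasurableSpace V] [BorelSpace V]
  [NormedAddCommGroup E] [InnerProductSpace ℝ E]
  [FiniteDimensional ℝ E] [MeasurableSpace E] [BorelSpace E]
  {Ψ : WithLp 2 (WithLp 2 (V × E) × ℝ) ≃ₗᵢ[ℝ] Euc n} {h : E → ℝ} {K : ℝ≥0}

/-- The projection `P` is a contraction with the isometric section `J`, so composing with `P`
preserves the norm of a linear form. If `h` is not differentiable, restriction along `J` shows the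
composite is not either, and both `fderiv` are 0. -/
theorem norm_fderiv_comp_snd (w : WithLp 2 (V × E)) :
    ‖fderiv ℝ (fun w : WithLp 2 (V × E) => h w.snd) w‖ = ‖fderiv ℝ h w.snd‖ := by
  set P : WithLp 2 (V × E) →L[ℝ] E := WithLp.sndL 2 ℝ V E with hP
  have hPle : ∀ x, ‖P x‖ ≤ ‖x‖ := by
    intro x
    change ‖x.snd‖ ≤ ‖x‖
    rw [WithLp.prod_norm_eq_of_L2]
    exact Real.le_sqrt_of_sq_le (le_add_of_nonneg_left (sq_nonneg _))
  set J : E →L[ℝ] WithLp 2 (V × E) := (WithLp.prodContinuousLinearEquiv 2 ℝ V E).symm.toContinuousLinearMap ∘L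
    ContinuousLinearMap.inr ℝ V E with hJ
  have hJapp : ∀ x, J x = WithLp.toLp 2 (0, x) := fun x => rfl
  have hPJ : ∀ x, P (J x) = x := fun x => rfl
  have hJn : ∀ x, ‖J x‖ = ‖x‖ := by
    intro x
    rw [hJapp, WithLp.prod_norm_eq_of_L2]
    simp
  by_cases hd : DifferentiableAt ℝ h w.snd
  · have h1 : HasFDerivAt (fun w : WithLp 2 (V × E) => h w.snd) (fderiv ℝ h w.snd ∘L P) w :=
      HasFDerivAt.comp w (g := h) hd.hasFDerivAt P.hasFDerivAt
    rw [h1.fderiv]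
    refine le_antisymm ?_ ?_
    · refine ContinuousLinearMap.opNorm_le_bound _ (norm_nonneg _) fun x => ?_
      exact ((fderiv ℝ h w.snd).le_opNorm (P x)).trans (by gcongr; exact hPle x)
    · refine ContinuousLinearMap.opNorm_le_bound _
        (norm_nonneg (fderiv ℝ h w.snd ∘L P)) fun x => ?_
      have h2 := (fderiv ℝ h w.snd ∘L P).le_opNorm (J x)
      rw [hJn] at h2
      exact h2
  · have hd' : ¬ DifferentiableAt ℝ (fun w : WithLp 2 (V × E) => h w.snd) w := by
      intro hd'
      refine hd ?_
      have h1 : DifferentiableAt ℝ (fun x : E => w + J (x - w.snd)) w.snd := by fun_prop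
      have h2 : DifferentiableAt ℝ (fun w : WithLp 2 (V × E) => h w.snd)
          ((fun x : E => w + J (x - w.snd)) w.snd) := by simpa using hd'
      have h3 := h2.comp w.snd h1
      refine h3.congr_of_eventuallyEq (Eventually.of_forall fun x => ?_)
      simp only [Function.comp_apply, hJapp]
      simp
    rw [fderiv_zero_of_not_differentiableAt hd, fderiv_zero_of_not_differentiableAt hd']
    exact (norm_zero (E := WithLp 2 (V × E) →L[ℝ] ℝ)).trans (norm_zero (E := E →L[ℝ] ℝ)).symm

theorem areaElement_comp_snd (w : WithLp 2 (V × E)) :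
    areaElement (fun w : WithLp 2 (V × E) => h w.snd) w = areaElement h w.snd := by
  rw [areaElement, areaElement, norm_fderiv_comp_snd]

theorem lipschitz_comp_snd (hh : LipschitzWith K h) :
    LipschitzWith K fun w : WithLp 2 (V × E) => h w.snd := by
  refine LipschitzWith.of_dist_le_mul fun x y => (hh.dist_le_mul _ _).trans ?_
  gcongr
  rw [WithLp.prod_dist_eq_of_L2]
  exact Real.le_sqrt_of_sq_le (le_add_of_nonneg_left (sq_nonneg _))

theorem measurePreserving_snd_ae {p : E → Prop} (hp : ∀ᵐ x, p x) :
    ∀ᵐ w : WithLp 2 (V × E), p w.snd := by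
  have h1 : Measure.QuasiMeasurePreserving (fun w : WithLp 2 (V × E) => w.snd) volume volume :=
    (Measure.quasiMeasurePreserving_snd (μ := (volume : Measure V)) (ν := (volume : Measure E))).comp
      (WithLp.volume_preserving_ofLp V E).quasiMeasurePreserving
  exact h1.ae hp

theorem integral_withLp_prod_mul (f : V → ℝ) (g : E → ℝ) :
    ∫ w : WithLp 2 (V × E), f w.fst * g w.snd = (∫ y, f y) * ∫ x, g x := by
  rw [← (WithLp.volume_preserving_toLp V E).integral_comp
    (MeasurableEquiv.toLp 2 (V × E)).measurableEmbedding, Measure.volume_eq_prod]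
  exact integral_prod_mul f g

theorem integrable_withLp_prod_mul {f : V → ℝ} {g : E → ℝ} (hf : Integrable f)
    (hg : Integrable g) : Integrable fun w : WithLp 2 (V × E) => f w.fst * g w.snd := by
  rw [← (WithLp.volume_preserving_toLp V E).integrable_comp_emb
    (MeasurableEquiv.toLp 2 (V × E)).measurableEmbedding, Measure.volume_eq_prod]
  exact hf.mul_prod hg

/-- The exponent of the test functions: linear in the axial direction, with a slow decay along the
edge. -/
def testExponent (Ψ : WithLp 2 (WithLp 2 (V × E) × ℝ) ≃ₗᵢ[ℝ] Euc n) (c ε : ℝ) (x : Euc n) : ℝ :=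
  -(c * (Ψ.symm x).snd) - ε * √(1 + ‖(Ψ.symm x).fst.fst‖ ^ 2)

theorem contDiff_testExponent (c ε : ℝ) : ContDiff ℝ ∞ (testExponent Ψ c ε) := by
  have h1 : ContDiff ℝ ∞ fun x => (Ψ.symm x).snd :=
    (WithLp.sndL 2 ℝ (WithLp 2 (V × E)) ℝ ∘L
      Ψ.symm.toContinuousLinearEquiv.toContinuousLinearMap).contDiff
  have h2 : ContDiff ℝ ∞ fun x => (Ψ.symm x).fst.fst :=
    (WithLp.fstL 2 ℝ V E ∘L WithLp.fstL 2 ℝ (WithLp 2 (V × E)) ℝ ∘L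
      Ψ.symm.toContinuousLinearEquiv.toContinuousLinearMap).contDiff
  refine (contDiff_const.mul h1).neg.sub (contDiff_const.mul ?_)
  exact (contDiff_const.add (h2.norm_sq ℝ)).sqrt fun x => by positivity

theorem abs_sqrt_one_add_sq_sub_le (a b : ℝ) : |√(1 + a ^ 2) - √(1 + b ^ 2)| ≤ |a - b| := by
  have ha := Real.sq_sqrt (by positivity : 0 ≤ 1 + a ^ 2)
  have hb := Real.sq_sqrt (by positivity : 0 ≤ 1 + b ^ 2)
  have ha0 := Real.sqrt_nonneg (1 + a ^ 2)
  have hb0 := Real.sqrt_nonneg (1 + b ^ 2)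
  have hab : 1 + a * b ≤ √(1 + a ^ 2) * √(1 + b ^ 2) := by
    rw [← Real.sqrt_mul (by positivity)]
    refine Real.le_sqrt_of_sq_le ?_
    nlinarith [sq_nonneg (a - b)]
  rw [← sq_le_sq]
  nlinarith

theorem norm_withLp_fst_le {A B : Type*} [NormedAddCommGroup A] [NormedAddCommGroup B]
    (p : WithLp 2 (A × B)) : ‖p.fst‖ ≤ ‖p‖ := by
  rw [WithLp.prod_norm_eq_of_L2]
  exact Real.le_sqrt_of_sq_le (le_add_of_nonneg_right (sq_nonneg _))

theorem norm_withLp_snd_le {A B : Type*} [NormedAddCommGroup A] [NormedAddCommGroup B]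
    (p : WithLp 2 (A × B)) : ‖p.snd‖ ≤ ‖p‖ := by
  rw [WithLp.prod_norm_eq_of_L2]
  exact Real.le_sqrt_of_sq_le (le_add_of_nonneg_left (sq_nonneg _))

theorem abs_testExponent_sub_le {c ε : ℝ} (hc : 0 ≤ c) (hε : 0 ≤ ε) (x y : Euc n) :
    |testExponent Ψ c ε x - testExponent Ψ c ε y| ≤ (c + ε) * dist x y := by
  have h0 : ‖Ψ.symm x - Ψ.symm y‖ = dist x y := by
    rw [← map_sub, LinearIsometryEquiv.norm_map, dist_eq_norm]
  have h1 : |(Ψ.symm x).snd - (Ψ.symm y).snd| ≤ dist x y := by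
    rw [← h0, ← WithLp.sub_snd, ← Real.norm_eq_abs]
    exact norm_withLp_snd_le _
  have h2 : |√(1 + ‖(Ψ.symm x).fst.fst‖ ^ 2) - √(1 + ‖(Ψ.symm y).fst.fst‖ ^ 2)| ≤
      dist x y := by
    refine (abs_sqrt_one_add_sq_sub_le _ _).trans ((abs_norm_sub_norm_le _ _).trans ?_)
    rw [← h0, ← WithLp.sub_fst, ← WithLp.sub_fst]
    exact (norm_withLp_fst_le _).trans (norm_withLp_fst_le _)
  have h3 : testExponent Ψ c ε x - testExponent Ψ c ε y =
      -(c * ((Ψ.symm x).snd - (Ψ.symm y).snd)) -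
        ε * (√(1 + ‖(Ψ.symm x).fst.fst‖ ^ 2) - √(1 + ‖(Ψ.symm y).fst.fst‖ ^ 2)) := by
    rw [testExponent, testExponent]
    ring
  rw [h3, add_mul]
  refine (abs_sub _ _).trans ?_
  rw [abs_neg, abs_mul, abs_mul, abs_of_nonneg hc, abs_of_nonneg hε]
  gcongr

theorem norm_fderiv_testExponent_le {c ε : ℝ} (hc : 0 ≤ c) (hε : 0 ≤ ε) (x : Euc n) :
    ‖fderiv ℝ (testExponent Ψ c ε) x‖ ≤ c + ε := by
  have hL : LipschitzWith (⟨c + ε, by positivity⟩ : ℝ≥0) (testExponent Ψ c ε) :=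
    LipschitzWith.of_dist_le_mul fun x y => abs_testExponent_sub_le hc hε x y
  exact norm_fderiv_le_of_lipschitz ℝ hL

/-- At height `s` over the graph the axial coordinate is `h + s`, so the squared test function
splits into factors for the edge, the base and the height, ready for Fubini. -/
theorem exp_testExponent_epiMap (c ε : ℝ) (p : WithLp 2 (V × E) × ℝ) :
    Real.exp (2 * testExponent Ψ c ε (epiMap Ψ (fun w => h w.snd) p)) =
      (Real.exp (-(2 * ε * √(1 + ‖p.1.fst‖ ^ 2))) * Real.exp (-(2 * c * h p.1.snd))) *
        Real.exp (-(2 * c) * p.2) := by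
  rw [← Real.exp_add, ← Real.exp_add]
  congr 1
  simp only [testExponent, epiMap, LinearIsometryEquiv.symm_apply_apply, WithLp.toLp_fst,
    WithLp.toLp_snd]
  ring

/-- The edge and base integrals cancel in the boundary-to-interior ratio, leaving `μ / (1 / (2c)) =
2cμ`. The gradient contributes at most `(c + ε)²`; `ε > 0` gives integrability along the edge, and
`κ > 0` across the base. -/
theorem bottom_epi_le (hh : LipschitzWith K h) {κ : ℝ} (hκ : 0 < κ) (hκh : ∀ x, κ * ‖x‖ ≤ h x)
    {c ε μ : ℝ} (hc : 0 < c) (hε : 0 < ε)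
    (hμ : ∫ x, Real.exp (-(2 * c * h x)) * areaElement h x =
      μ * ∫ x, Real.exp (-(2 * c * h x))) :
    bottom (epi Ψ fun w => h w.snd) 1 ≤ (((c + ε) ^ 2 - 2 * c * μ : ℝ) : EReal) := by
  set H : WithLp 2 (V × E) → ℝ := fun w => h w.snd with hHdef
  have hH : LipschitzWith K H := lipschitz_comp_snd hh
  set f : V → ℝ := fun y => Real.exp (-(2 * ε * √(1 + ‖y‖ ^ 2))) with hf
  set g : E → ℝ := fun x => Real.exp (-(2 * c * h x)) with hg
  have hfi : Integrable f := by
    refine (integrable_exp_neg_mul_norm volume (a := 2 * ε) (by positivity)).mono'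
      (by fun_prop) (Eventually.of_forall fun y => ?_)
    rw [Real.norm_of_nonneg (Real.exp_pos _).le]
    gcongr
    exact Real.le_sqrt_of_sq_le (by linarith)
  have hgi : Integrable g := by
    have := hh.continuous
    refine (integrable_exp_neg_mul_norm volume (a := 2 * c * κ) (by positivity)).mono'
      (by fun_prop) (Eventually.of_forall fun x => ?_)
    rw [Real.norm_of_nonneg (Real.exp_pos _).le]
    rw [mul_assoc (2 * c)]
    gcongr
    exact hκh x
  have hfpos : 0 < ∫ y, f y := integral_exp_pos hfi
  have hgpos : 0 < ∫ x, g x := integral_exp_pos hgi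
  have hki : IntegrableOn (fun s : ℝ => Real.exp (-(2 * c) * s)) (Ioi 0) :=
    integrableOn_exp_mul_Ioi (by linarith) 0
  have hk : ∫ s in Ioi (0 : ℝ), Real.exp (-(2 * c) * s) = 1 / (2 * c) := by
    rw [integral_exp_mul_Ioi (by linarith)]
    simp
  have hemb := measurableEmbedding_epiMap (Ψ := Ψ) hH.continuous
  have hmp := measurePreserving_epiMap (Ψ := Ψ) hH.continuous
  have hFi := integrable_withLp_prod_mul hfi hgi
  have hcomp : (fun x => Real.exp (2 * testExponent Ψ c ε x)) ∘ epiMap Ψ H =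
      fun p => (f p.1.fst * g p.1.snd) * Real.exp (-(2 * c) * p.2) :=
    funext fun p => exp_testExponent_epiMap c ε p
  have hint : IntegrableOn (fun x => Real.exp (2 * testExponent Ψ c ε x)) (epi Ψ H) := by
    rw [IntegrableOn, ← hmp.integrable_comp_emb hemb, hcomp]
    exact hFi.mul_prod hki
  have hI : ∫ x in epi Ψ H, Real.exp (2 * testExponent Ψ c ε x) =
      ((∫ y, f y) * ∫ x, g x) * (1 / (2 * c)) := by
    rw [← hmp.integral_comp hemb, ← hk, ← integral_withLp_prod_mul, ← integral_prod_mul]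
    exact integral_congr_ae (Eventually.of_forall fun p => congrFun hcomp p)
  have hgr : ∀ w, Real.exp (2 * testExponent Ψ c ε (epiMap Ψ H (w, 0))) =
      f w.fst * g w.snd := by
    intro w
    have := exp_testExponent_epiMap (Ψ := Ψ) (h := h) c ε (w, 0)
    simpa using this
  have hbd : Integrable (fun x => Real.exp (2 * testExponent Ψ c ε x))
      (bdryMeasure (epi Ψ H)) := by
    refine integrable_bdryMeasure_epi hH ?_
    simp only [hgr]
    exact hFi
  have hB : ∫ x, Real.exp (2 * testExponent Ψ c ε x) ∂(bdryMeasure (epi Ψ H)) =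
      (∫ y, f y) * (μ * ∫ x, g x) := by
    rw [integral_bdryMeasure_epi hH, ← hμ, ← integral_withLp_prod_mul]
    refine integral_congr_ae (Eventually.of_forall fun w => ?_)
    dsimp only
    rw [hgr, areaElement_comp_snd]
    ring
  have h1 := bottom_le_of_exp hH (contDiff_testExponent c ε)
    (norm_fderiv_testExponent_le (Ψ := Ψ) hc.le hε.le) hint hbd
  rw [hI, hB] at h1
  refine h1.trans (le_of_eq ?_)
  congr 2
  field_simp

/-- The choice `c = μ` minimises `c² - 2cμ`, and then `ε → 0`. -/
theorem bottom_epi_le_neg_sq (hh : LipschitzWith K h) {κ : ℝ} (hκ : 0 < κ)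
    (hκh : ∀ x, κ * ‖x‖ ≤ h x) {μ : ℝ} (hμ0 : 0 < μ)
    (hμ : ∫ x, Real.exp (-(2 * μ * h x)) * areaElement h x =
      μ * ∫ x, Real.exp (-(2 * μ * h x))) :
    bottom (epi Ψ fun w => h w.snd) 1 ≤ ((-(μ ^ 2) : ℝ) : EReal) := by
  have h1 : Tendsto (fun ε : ℝ => (((μ + ε) ^ 2 - 2 * μ * μ : ℝ) : EReal)) (𝓝[>] 0)
      (𝓝 (((μ + 0) ^ 2 - 2 * μ * μ : ℝ) : EReal)) := by
    refine (continuous_coe_real_ereal.tendsto _).comp ?_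
    exact Tendsto.mono_left (Continuous.tendsto (by fun_prop) 0) nhdsWithin_le_nhds
  have h2 : (μ + 0) ^ 2 - 2 * μ * μ = -(μ ^ 2) := by ring
  rw [h2] at h1
  exact ge_of_tendsto h1 (eventually_mem_nhdsWithin.mono fun ε hε =>
    bottom_epi_le hh hκ hκh hμ0 hε hμ)

end ProductEpigraph

/-! ### The two bounds for the model cone -/

section Cylinder

variable {m j : ℕ} {M : Set (Sph j)} {θ : Sph j}

theorem norm_perp_add_smul_sq (η : Perp θ) (t : ℝ) :
    ‖(η : Euc j) + t • (θ : Euc j)‖ ^ 2 = ‖η‖ ^ 2 + ‖t‖ ^ 2 := by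
  rw [norm_add_sq_real, inner_smul_right, real_inner_comm, inner_perp, norm_smul,
    norm_eq_of_mem_sphere θ, Submodule.coe_norm]
  ring

/-- The coordinates on `ℝ^m = ℝ^{m-j} × ℝ^j` in which the second factor is split into `θ^⊥` and the
axis through `θ`. -/
def axialIsometry (A : Euc m ≃ₗᵢ[ℝ] WithLp 2 (Euc (m - j) × Euc j)) (θ : Sph j) :
    WithLp 2 (WithLp 2 (Euc (m - j) × Perp θ) × ℝ) →ₗᵢ[ℝ] Euc m where
  toFun p := A.symm (WithLp.toLp 2 (p.fst.fst, (p.fst.snd : Euc j) + p.snd • (θ : Euc j)))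
  map_add' p q := by
    rw [← map_add]
    refine congrArg A.symm (congrArg (WithLp.toLp 2) (Prod.ext rfl ?_))
    change ((p.fst.snd : Euc j) + q.fst.snd) + (p.snd + q.snd) • (θ : Euc j) =
      ((p.fst.snd : Euc j) + p.snd • (θ : Euc j)) + (q.fst.snd + q.snd • (θ : Euc j))
    rw [add_smul]
    abel
  map_smul' c p := by
    rw [RingHom.id_apply, ← map_smul]
    refine congrArg A.symm (congrArg (WithLp.toLp 2) (Prod.ext rfl ?_))
    change c • (p.fst.snd : Euc j) + (c * p.snd) • (θ : Euc j) =
      c • ((p.fst.snd : Euc j) + p.snd • (θ : Euc j))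
    rw [smul_add, mul_smul]
  norm_map' p := by
    change ‖A.symm (WithLp.toLp 2 (p.fst.fst, (p.fst.snd : Euc j) + p.snd • (θ : Euc j)))‖ = ‖p‖
    rw [LinearIsometryEquiv.norm_map, WithLp.prod_norm_eq_of_L2, WithLp.prod_norm_eq_of_L2 p,
      WithLp.prod_norm_sq_eq_of_L2 p.fst]
    simp only [WithLp.toLp_fst, WithLp.toLp_snd]
    rw [norm_perp_add_smul_sq, add_assoc]

theorem finrank_withLp_prod {V E : Type*} [NormedAddCommGroup V] [InnerProductSpace ℝ V]
    [FiniteDimensional ℝ V] [NormedAddCommGroup E] [InnerProductSpace ℝ E]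
    [FiniteDimensional ℝ E] : Module.finrank ℝ (WithLp 2 (V × E)) =
      Module.finrank ℝ V + Module.finrank ℝ E := by
  rw [(WithLp.linearEquiv 2 ℝ (V × E)).finrank_eq, Module.finrank_prod]

/-- `axialIsometry` as an equivalence. -/
def axialEquiv (hj : 1 ≤ j) (hjm : j ≤ m)
    (A : Euc m ≃ₗᵢ[ℝ] WithLp 2 (Euc (m - j) × Euc j)) (θ : Sph j) :
    WithLp 2 (WithLp 2 (Euc (m - j) × Perp θ) × ℝ) ≃ₗᵢ[ℝ] Euc m :=
  (axialIsometry A θ).toLinearIsometryEquiv (by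
    rw [finrank_withLp_prod, finrank_withLp_prod, finrank_perp, finrank_euclideanSpace_fin,
      finrank_euclideanSpace_fin, Module.finrank_self]
    omega)

theorem Good.cylinder_eq_epi (h : Good M θ) (hj : 1 ≤ j) (hjm : j ≤ m)
    (A : Euc m ≃ₗᵢ[ℝ] WithLp 2 (Euc (m - j) × Euc j)) :
    cylinder A (cone M) = epi (axialEquiv hj hjm A θ) fun w => profile M θ w.snd := by
  ext x
  obtain ⟨p, rfl⟩ := (axialEquiv hj hjm A θ).surjective x
  have h1 : (A (axialEquiv hj hjm A θ p)).snd = (p.fst.snd : Euc j) + p.snd • (θ : Euc j) := by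
    change (A (A.symm _)).snd = _
    rw [LinearIsometryEquiv.apply_symm_apply, WithLp.toLp_snd]
  rw [cylinder, mem_ofPred_eq, h1, h.mem_cone_iff, epi, mem_ofPred_eq,
    LinearIsometryEquiv.symm_apply_apply]

theorem Good.sq_meanSig_le_coneConst (h : Good M θ) (hj : 1 ≤ j) (hjm : j ≤ m)
    (A : Euc m ≃ₗᵢ[ℝ] WithLp 2 (Euc (m - j) × Euc j)) :
    ((meanSig M θ ^ 2 : ℝ) : EReal) ≤ coneConst (cylinder A (cone M)) := by
  obtain ⟨K, hK⟩ := h.exists_lipschitz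
  obtain ⟨κ, hκ, hle⟩ := h.exists_pos_mul_norm_le
  rw [coneConst, h.cylinder_eq_epi hj hjm A, EReal.le_neg, ← EReal.coe_neg]
  exact bottom_epi_le_neg_sq hK hκ hle h.meanSig_pos
    (h.meanSig_eq (mul_pos two_pos h.meanSig_pos))

theorem Good.coneConst_le_sq (h : Good M θ) (hj : 1 ≤ j) (hjm : j ≤ m)
    (A : Euc m ≃ₗᵢ[ℝ] WithLp 2 (Euc (m - j) × Euc j)) {S : ℝ}
    (hS : ∀ φ, BDiff M θ φ → Sig M θ φ ≤ S) :
    coneConst (cylinder A (cone M)) ≤ ((S ^ 2 : ℝ) : EReal) := by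
  obtain ⟨K, hK⟩ := h.exists_lipschitz
  have := h.nontrivial
  -- Homogeneity of degree zero carries the bound from the good directions on the sphere to almost
  -- every `η`.
  have h1 : ∀ᵐ η : Perp θ, areaElement (profile M θ) η ≤ S := by
    have h0 : ∀ᵐ η : Perp θ, η ≠ 0 := Measure.ae_ne volume 0
    filter_upwards [hK.ae_differentiableAt, h0] with η hd hη
    have hn : 0 < ‖η‖⁻¹ := inv_pos.2 (norm_pos_iff.2 hη)
    set φ : SphPerp θ := ⟨‖η‖⁻¹ • η, by
      rw [mem_sphere_zero_iff_norm, norm_smul, norm_inv, norm_norm,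
        inv_mul_cancel₀ (norm_ne_zero_iff.2 hη)]⟩
    have hφ : BDiff M θ φ := (h.bDiff_iff φ).2
      (hasFDerivAt_profile_smul hn hd.hasFDerivAt).differentiableAt
    rw [← areaElement_profile_smul η hn]
    exact (h.sig_eq φ hφ).symm.trans_le (hS φ hφ)
  rw [coneConst, h.cylinder_eq_epi hj hjm A, EReal.neg_le, ← EReal.coe_neg]
  refine neg_sq_le_bottom (lipschitz_comp_snd hK) ?_
  filter_upwards [measurePreserving_snd_ae (V := Euc (m - j)) h1] with w hw
  rwa [areaElement_comp_snd]

theorem Good.coneConst_le_iSup (h : Good M θ) (hj : 1 ≤ j) (hjm : j ≤ m)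
    (A : Euc m ≃ₗᵢ[ℝ] WithLp 2 (Euc (m - j) × Euc j)) :
    coneConst (cylinder A (cone M)) ≤
    ⨆ (φ : SphPerp θ) (_ : BDiff M θ φ), ((Sig M θ φ ^ 2 : ℝ) : EReal) := by
  refine EReal.le_of_forall_lt_iff_le.1 fun T hT => ?_
  -- One point of differentiability forces `T ≥ 0`, so that `S = √T` satisfies `S² = T`.
  obtain ⟨φ, hφ⟩ : ∃ φ, BDiff M θ φ := by
    have : (ae (sphMeasure θ)).NeBot := ae_neBot.2 h.sphMeasure_ne_zero
    exact h.ae_bDiff.exists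
  have h1 : ∀ φ, BDiff M θ φ → Sig M θ φ ^ 2 ≤ T := fun φ hφ =>
    EReal.coe_le_coe_iff.1 ((le_iSup₂_of_le φ hφ le_rfl).trans hT.le)
  have hT0 : 0 ≤ T := (sq_nonneg _).trans (h1 φ hφ)
  have h2 := h.coneConst_le_sq hj hjm A (S := √T) fun φ hφ => Real.le_sqrt_of_sq_le (h1 φ hφ)
  rwa [Real.sq_sqrt hT0] at h2

end Cylinder

/-! ### Polyhedra with an inscribed ball -/

section Inscribed

variable {j : ℕ} {M : Set (Sph j)} {θ : Sph j} {N : Finset (Euc j)} {r : ℝ}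

theorem HasInscribedBall.inner_pos (h : HasInscribedBall M N θ r) (hθ : θ ∈ M) {n : Euc j}
    (hn : n ∈ N) : 0 < ⟪n, (θ : Euc j)⟫ := by
  rw [h.polyhedron] at hθ
  exact hθ n hn

/-- For the touching point `p`, `⟪n, p⟫ = 0` gives `⟪n, θ⟫ = ⟪n, θ - cos r • p⟫`, and that vector
has length `sin r`. -/
theorem HasInscribedBall.inner_le (h : HasInscribedBall M N θ r) {n : Euc j} (hn : n ∈ N) :
    ⟪n, (θ : Euc j)⟫ ≤ ‖n‖ * Real.sin r := by
  obtain ⟨p, -, hp0, hpr⟩ := h.touches n hn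
  have hr : r ≤ Real.pi := hpr ▸ InnerProductGeometry.angle_le_pi _ _
  have hs : 0 ≤ Real.sin r := Real.sin_nonneg_of_nonneg_of_le_pi h.pos.le hr
  have hcos : ⟪(θ : Euc j), (p : Euc j)⟫ = Real.cos r := by
    rw [← hpr, InnerProductGeometry.cos_angle, norm_eq_of_mem_sphere θ, norm_eq_of_mem_sphere p]
    simp
  have h1 : ‖(θ : Euc j) - Real.cos r • (p : Euc j)‖ = Real.sin r := by
    refine (sq_eq_sq₀ (norm_nonneg _) hs).1 ?_
    rw [norm_sub_sq_real, inner_smul_right, hcos, norm_smul, norm_eq_of_mem_sphere θ,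
      norm_eq_of_mem_sphere p, mul_one, Real.norm_eq_abs, sq_abs, Real.sin_sq]
    ring
  have h2 := real_inner_le_norm n ((θ : Euc j) - Real.cos r • (p : Euc j))
  rwa [inner_sub_right, inner_smul_right, hp0, mul_zero, sub_zero, h1] at h2

/-- If `θ` were closer to the hyperplane `n^⊥`, the normalised projection `x` of `θ` onto `n^⊥`
would be at angle less than `r` from `θ`. It would then lie in `M`, although `⟪n, x⟫ = 0`. -/
theorem HasInscribedBall.inner_eq (h : HasInscribedBall M N θ r) (hθ : θ ∈ M) {n : Euc j}
    (hn : n ∈ N) : ⟪n, (θ : Euc j)⟫ = ‖n‖ * Real.sin r := by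
  refine le_antisymm (h.inner_le hn) (not_lt.1 fun hlt => ?_)
  have hpos := h.inner_pos hθ hn
  have hn0 : n ≠ 0 := fun h0 => by simp [h0] at hpos
  have hnn : 0 < ‖n‖ := norm_pos_iff.2 hn0
  obtain ⟨p, -, -, hpr⟩ := h.touches n hn
  have hr : r ≤ Real.pi := hpr ▸ InnerProductGeometry.angle_le_pi _ _
  set a : ℝ := ⟪n, (θ : Euc j)⟫ / ‖n‖ with ha
  have ha0 : 0 < a := div_pos hpos hnn
  have han : ⟪n, (θ : Euc j)⟫ = a * ‖n‖ := (div_mul_cancel₀ _ hnn.ne').symm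
  have has : a < Real.sin r := by
    rw [ha, div_lt_iff₀ hnn, mul_comm]
    exact hlt
  have hcos : Real.cos r ^ 2 < 1 - a ^ 2 := by
    rw [Real.cos_sq']
    nlinarith
  have hd : 0 < 1 - a ^ 2 := (sq_nonneg _).trans_lt hcos
  set d : ℝ := √(1 - a ^ 2) with hdef
  have hd0 : 0 < d := Real.sqrt_pos.2 hd
  have hd2 : d ^ 2 = 1 - a ^ 2 := Real.sq_sqrt hd.le
  set x : Euc j := d⁻¹ • ((θ : Euc j) - (a / ‖n‖) • n) with hx
  have hθθ : ⟪(θ : Euc j), (θ : Euc j)⟫ = 1 := by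
    rw [real_inner_self_eq_norm_sq, norm_eq_of_mem_sphere θ, one_pow]
  have h1 : ⟪n, x⟫ = 0 := by
    rw [hx, inner_smul_right, inner_sub_right, inner_smul_right, han, real_inner_self_eq_norm_sq]
    field_simp
    ring
  have h2 : ⟪(θ : Euc j), x⟫ = d := by
    rw [hx, inner_smul_right, inner_sub_right, inner_smul_right,
      real_inner_comm n, han, hθθ]
    have : 1 - a / ‖n‖ * (a * ‖n‖) = d ^ 2 := by
      rw [hd2]
      field_simp
    rw [this]
    field_simp
  have h3 : ‖x‖ = 1 := by
    have : ⟪x, x⟫ = 1 := by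
      nth_rewrite 1 [hx]
      rw [inner_smul_left, inner_sub_left, inner_smul_left, h1, h2]
      simp [hd0.ne']
    rw [real_inner_self_eq_norm_sq] at this
    exact (pow_eq_one_iff_of_nonneg (norm_nonneg _) two_ne_zero).1 this
  have h4 : InnerProductGeometry.angle (θ : Euc j) x < r := by
    rw [InnerProductGeometry.angle, h2, h3, norm_eq_of_mem_sphere θ, mul_one, div_one,
      ← Real.arccos_cos h.pos.le hr]
    have hd1 : d ≤ 1 := by nlinarith
    refine Real.strictAntiOn_arccos ⟨Real.neg_one_le_cos _, Real.cos_le_one _⟩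
      ⟨by linarith, hd1⟩ ?_
    rw [hdef]
    exact Real.lt_sqrt_of_sq_lt hcos
  have h5 : (⟨x, mem_sphere_zero_iff_norm.2 h3⟩ : Sph j) ∈ M := h.ball_subset _ h4
  rw [h.polyhedron] at h5
  exact (h5 n hn).ne' h1

/-- With no normals `M` would be the whole sphere and contain `-θ`, which the epigraph description
excludes. -/
theorem Good.nonempty_normals (hg : Good M θ) (h : HasInscribedBall M N θ r) : N.Nonempty := by
  by_contra hN
  rw [Finset.not_nonempty_iff_eq_empty] at hN
  have h1 : -θ ∈ M := by
    rw [h.polyhedron]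
    simp [hN]
  have h2 := (hg.mem_cone_iff 0 (-1)).1 (by simpa using coe_mem_cone h1)
  rw [profile, gauge_zero] at h2
  linarith

theorem Good.profile_lt_iff (hg : Good M θ) (h : HasInscribedBall M N θ r) (η : Perp θ) (t : ℝ) :
    profile M θ η < t ↔ ∀ n ∈ N, 0 < ⟪n, (η : Euc j)⟫ + t * (‖n‖ * Real.sin r) := by
  have key : (η : Euc j) + t • (θ : Euc j) ∈ cone M ↔
      ∀ n ∈ N, 0 < ⟪n, (η : Euc j) + t • (θ : Euc j)⟫ := by
    set z : Euc j := (η : Euc j) + t • (θ : Euc j)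
    constructor
    · rintro ⟨x, hx, s, hs, hz⟩ n hn
      rw [hz, inner_smul_right]
      rw [h.polyhedron] at hx
      exact mul_pos hs (hx n hn)
    · intro hz
      obtain ⟨n, hn⟩ := hg.nonempty_normals h
      have hz0 : z ≠ 0 := fun h0 => by simpa [h0] using hz n hn
      have hz1 : 0 < ‖z‖ := norm_pos_iff.2 hz0
      refine ⟨⟨‖z‖⁻¹ • z, by
        rw [mem_sphere_zero_iff_norm, norm_smul, norm_inv, norm_norm,
          inv_mul_cancel₀ hz1.ne']⟩, ?_, ‖z‖, hz1, ?_⟩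
      · rw [h.polyhedron]
        intro n hn
        simpa only [inner_smul_right] using mul_pos (inv_pos.2 hz1) (hz n hn)
      · rw [smul_smul, mul_inv_cancel₀ hz1.ne', one_smul]
  rw [← hg.mem_cone_iff, key]
  refine forall₂_congr fun n hn => ?_
  rw [inner_add_right, inner_smul_right, h.inner_eq hg.mem hn]

theorem norm_eq_of_innerSL_add_smul_eq_zero {E : Type*} [NormedAddCommGroup E]
    [InnerProductSpace ℝ E] {P : E} {c : ℝ} (hc : 0 ≤ c) {f : E →L[ℝ] ℝ}
    (h : innerSL ℝ P + c • f = 0) : ‖P‖ = c * ‖f‖ := by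
  rw [← innerSL_apply_norm (𝕜 := ℝ) P, eq_neg_of_add_eq_zero_left h, norm_neg, norm_smul,
    Real.norm_of_nonneg hc]

/-- Let `P` be the projection to `θ^⊥` of the normal `n` of a face active at `η`. Then `⟪P, ξ⟫ + ‖n‖
sin r · h(ξ)` is nonnegative and vanishes at `η`, a minimum, so `∇h = -P / (‖n‖ sin r)`. Since `‖P‖²
= ‖n‖² (1 - sin² r)`, the slope does not depend on the face. -/
theorem Good.areaElement_profile_eq (hg : Good M θ) (h : HasInscribedBall M N θ r) {η : Perp θ}
    (hd : DifferentiableAt ℝ (profile M θ) η) :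
    areaElement (profile M θ) η = (Real.sin r)⁻¹ := by
  obtain ⟨n, hn, hact⟩ : ∃ n ∈ N,
      ⟪n, (η : Euc j)⟫ + profile M θ η * (‖n‖ * Real.sin r) ≤ 0 := by
    by_contra! hcon
    exact lt_irrefl _ ((hg.profile_lt_iff h η _).2 hcon)
  have hall : ∀ ξ : Perp θ, 0 ≤ ⟪n, (ξ : Euc j)⟫ + profile M θ ξ * (‖n‖ * Real.sin r) := by
    intro ξ
    have h1 : Tendsto (fun t => ⟪n, (ξ : Euc j)⟫ + t * (‖n‖ * Real.sin r))
        (𝓝[>] (profile M θ ξ)) (𝓝 (⟪n, (ξ : Euc j)⟫ + profile M θ ξ * (‖n‖ * Real.sin r))) :=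
      Tendsto.mono_left (Continuous.tendsto (by fun_prop) _) nhdsWithin_le_nhds
    exact ge_of_tendsto h1 (eventually_mem_nhdsWithin.mono fun t ht =>
      ((hg.profile_lt_iff h ξ t).1 ht n hn).le)
  have hns : 0 < ‖n‖ * Real.sin r := (h.inner_eq hg.mem hn) ▸ h.inner_pos hg.mem hn
  have hn0 : 0 < ‖n‖ := by
    refine (norm_nonneg n).lt_of_ne fun h0 => ?_
    rw [← h0, zero_mul] at hns
    exact hns.false
  have hs : 0 < Real.sin r := (mul_pos_iff_of_pos_left hn0).1 hns
  set P : Perp θ := (Perp θ).orthogonalProjectionOnto n with hP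
  have hPin : ∀ ξ : Perp θ, ⟪n, (ξ : Euc j)⟫ = ⟪P, ξ⟫ := by
    intro ξ
    conv_lhs => rw [← proj_perp_add_inner_smul (θ := θ) n, inner_add_left, inner_smul_left,
      inner_perp, mul_zero, add_zero]
    rfl
  set L : Perp θ →L[ℝ] ℝ := innerSL ℝ P + (‖n‖ * Real.sin r) • fderiv ℝ (profile M θ) η with hL
  have hF : HasFDerivAt (fun ξ : Perp θ => ⟪P, ξ⟫ + (‖n‖ * Real.sin r) * profile M θ ξ) L η :=
    (innerSL ℝ P).hasFDerivAt.add (hd.hasFDerivAt.const_mul _)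
  have hmin : IsLocalMin (fun ξ : Perp θ => ⟪P, ξ⟫ + (‖n‖ * Real.sin r) * profile M θ ξ) η := by
    refine Eventually.of_forall fun ξ => ?_
    have h1 := hall ξ
    rw [hPin] at h1 hact
    dsimp only
    linarith
  have hL0 := hmin.hasFDerivAt_eq_zero hF
  have hnorm : ‖P‖ = ‖n‖ * Real.sin r * ‖fderiv ℝ (profile M θ) η‖ :=
    norm_eq_of_innerSL_add_smul_eq_zero hns.le hL0
  have hPn : ‖n‖ ^ 2 = ‖P‖ ^ 2 + (‖n‖ * Real.sin r) ^ 2 := by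
    have h1 := norm_perp_add_smul_sq P ⟪(θ : Euc j), n⟫
    rwa [hP, proj_perp_add_inner_smul, real_inner_comm, h.inner_eq hg.mem hn,
      Real.norm_of_nonneg hns.le] at h1
  have hfin : 1 + ‖fderiv ℝ (profile M θ) η‖ ^ 2 = ((Real.sin r)⁻¹) ^ 2 := by
    rw [hnorm] at hPn
    have hn2 : ‖n‖ ^ 2 ≠ 0 := by positivity
    have h1 : 1 = Real.sin r ^ 2 * (1 + ‖fderiv ℝ (profile M θ) η‖ ^ 2) := by
      apply mul_left_cancel₀ hn2
      linarith
    rw [inv_pow]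
    exact eq_inv_of_mul_eq_one_right h1.symm
  rw [areaElement, hfin, Real.sqrt_sq (by positivity)]

theorem Good.sig_eq_inv_sin (hg : Good M θ) (h : HasInscribedBall M N θ r) {φ : SphPerp θ}
    (hφ : BDiff M θ φ) : Sig M θ φ = (Real.sin r)⁻¹ := by
  rw [hg.sig_eq φ hφ, hg.areaElement_profile_eq h ((hg.bDiff_iff φ).1 hφ)]

theorem Good.meanSig_eq_inv_sin (hg : Good M θ) (h : HasInscribedBall M N θ r) :
    meanSig M θ = (Real.sin r)⁻¹ := by
  have h1 : ∫ φ, b M θ φ ^ (j - 1) * Sig M θ φ ∂(sphMeasure θ) =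
      ∫ φ, b M θ φ ^ (j - 1) * (Real.sin r)⁻¹ ∂(sphMeasure θ) := by
    refine integral_congr_ae ?_
    filter_upwards [hg.ae_bDiff] with φ hφ
    rw [hg.sig_eq_inv_sin h hφ]
  rw [meanSig, h1, integral_mul_const, mul_div_cancel_left₀ _ (hg.integral_b_pow_pos _).ne']

end Inscribed

/-- Points of `Ω` arbitrarily near the boundary point `y` exist, and the inverse diffeomorphism
sends them into the cone. -/
theorem nonempty_of_isModelCone {m j : ℕ} {Ω : Set (Euc m)} {y : Euc m} (hy : y ∈ frontier Ω)
    {M : Set (Sph j)} {A : Euc m ≃ₗᵢ[ℝ] WithLp 2 (Euc (m - j) × Euc j)}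
    (hK : IsModelCone Ω y (cylinder A (cone M))) : M.Nonempty := by
  obtain ⟨-, r, hr, f, f', -, -, -, -, -, hf', -⟩ := hK
  obtain ⟨z, hz, hzr⟩ := Metric.mem_closure_iff.1 (frontier_subset_closure hy) r hr
  obtain ⟨⟨x, hx, -⟩, -⟩ := hf' ⟨hz, mem_ball'.2 hzr⟩
  exact ⟨x, hx⟩

end Robin

end

/-! ### The two-sided bounds and their exactness -/

theorem mainTheorem5 (m j : ℕ) (hj : 4 ≤ j) (hjm : j ≤ m)
    -- an open set with a boundary point `y`
    (Ω : Set (Robin.Euc m)) (hΩ : IsOpen Ω) (y : Robin.Euc m) (hy : y ∈ frontier Ω)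
    -- an open, geodesically convex cross-section, with closure in an open hemisphere
    (M : Set (Robin.Sph j)) (hMopen : IsOpen M) (hMconv : Convex ℝ (Robin.cone M))
    (hMhemi : ∃ e : Robin.Euc j, ∀ x ∈ closure M, 0 < ⟪e, (x : Robin.Euc j)⟫)
    -- `y` is a singular point of codimension `j` with this cross-section
    (A : Robin.Euc m ≃ₗᵢ[ℝ] WithLp 2 (Robin.Euc (m - j) × Robin.Euc j))
    (hK : Robin.IsModelCone Ω y (Robin.cylinder A (Robin.cone M))) :
    -- the quantities in the bounds are well defined
    (∃ θ, Robin.Admissible M θ) ∧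
    (∀ θ, Robin.Admissible M θ →
      Robin.sectionBdry M θ =
        {z | ∃ φ : Robin.SphPerp θ,
          z = (θ : Robin.Euc j) + Robin.b M θ φ • ((φ : Robin.Perp θ) : Robin.Euc j)} ∧
      (∀ᵐ φ ∂(Robin.sphMeasure θ), Robin.BDiff M θ φ) ∧
      Integrable (fun φ : Robin.SphPerp θ => Robin.b M θ φ ^ (j - 1) * Robin.Sig M θ φ)
        (Robin.sphMeasure θ) ∧
      Integrable (fun φ : Robin.SphPerp θ => Robin.b M θ φ ^ (j - 1)) (Robin.sphMeasure θ) ∧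
      0 < ∫ φ, Robin.b M θ φ ^ (j - 1) ∂(Robin.sphMeasure θ)) ∧
    -- the two-sided bounds
    Robin.lowerBound M ≤ Robin.coneConst (Robin.cylinder A (Robin.cone M)) ∧
    Robin.coneConst (Robin.cylinder A (Robin.cone M)) ≤ Robin.upperBound M ∧
    -- exactness for polyhedra with an inscribed ball
    (∀ (N : Finset (Robin.Euc j)) (θ : Robin.Sph j) (r : ℝ),
      Robin.HasInscribedBall M N θ r → Robin.Admissible M θ →
      Robin.lowerBound M = Robin.coneConst (Robin.cylinder A (Robin.cone M)) ∧
      Robin.coneConst (Robin.cylinder A (Robin.cone M)) = Robin.upperBound M) := by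
  have hne := Robin.nonempty_of_isModelCone hy hK
  have hgood : ∀ θ, Robin.Admissible M θ → Robin.Good M θ := fun θ hθ =>
    Robin.good_of_admissible (by omega) hMopen hMconv hMhemi hθ
  have hj1 : 1 ≤ j := by omega
  have hlower : Robin.lowerBound M ≤ Robin.coneConst (Robin.cylinder A (Robin.cone M)) :=
    iSup₂_le fun θ hθ => (hgood θ hθ).sq_meanSig_le_coneConst hj1 hjm A
  have hupper : Robin.coneConst (Robin.cylinder A (Robin.cone M)) ≤ Robin.upperBound M :=
    le_iInf₂ fun θ hθ => (hgood θ hθ).coneConst_le_iSup hj1 hjm A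
  refine ⟨Robin.exists_admissible hMopen hMconv hne hMhemi, fun θ hθ => ?_, hlower, hupper,
    fun N θ r hball hθ => ?_⟩
  · have h := hgood θ hθ
    exact ⟨h.sectionBdry_eq, h.ae_bDiff, h.integrable_b_pow_mul_sig (j - 1),
      h.integrable_b_pow (j - 1), h.integral_b_pow_pos (j - 1)⟩
  · have h := hgood θ hθ
    -- The centre `θ` alone puts `1 / sin² r` below the supremum and above the infimum, which closes
    -- the chain of inequalities.
    have h1 : (((Real.sin r)⁻¹ ^ 2 : ℝ) : EReal) ≤ Robin.lowerBound M := by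
      rw [← h.meanSig_eq_inv_sin hball]
      exact le_iSup₂_of_le θ hθ le_rfl
    have h2 : Robin.upperBound M ≤ (((Real.sin r)⁻¹ ^ 2 : ℝ) : EReal) :=
      iInf₂_le_of_le θ hθ (iSup₂_le fun φ hφ => by rw [h.sig_eq_inv_sin hball hφ])
    exact ⟨hlower.antisymm (hupper.trans (h2.trans h1)),
      hupper.antisymm (h2.trans (h1.trans hlower))⟩
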